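/- All graphs are finite and simple. For a graph $G$ with $n$ vertices let $\mu_1\ge\mu_2\ge\cdots\ge\mu_n=0$ be the eigenvalues of its Laplacian matrix $L(G)=D(G)-A(G)$, where $D(G)$ is the diagonal matrix of vertex degrees and $A(G)$ the adjacency matrix, and let $LEL(G)=\sum_{k=1}^{n-1}\sqrt{\mu_k}$ be its Laplacian-like energy. A graph is unicyclic if it is connected and has as many edges as vertices; a leaf is a vertex of degree one. Every unicyclic graph of girth $g$ is of the form $C_{T_1,\dots,T_g}$, that is, it is obtained from a cycle $u_1u_2\cdots u_g$ by attaching rooted trees $T_1,\dots,T_g$ with roots at $u_1,\dots,u_g$, respectively. Let $\mathcal{U}_{n,l}^{g,2}$ be the set of unicyclic graphs $G=C_{T_1,\dots,T_g}$ with $n$ vertices, $l$ leaves and girth $g$ for which exactly two of the trees $T_1,\dots,T_g$ have more than one vertex. Let $U^0=U_{n,l}^{g,0}$ be the graph on $n$ vertices obtained from a cycle of length $g$ by attaching at one and the same vertex of the cycle $l$ pendent paths, each of length $\lfloor\frac{n-g}{l}\rfloor$ or $\lceil\frac{n-g}{l}\rceil$. **Corollary 3.6.** For every graph $G\in\mathcal{U}_{n,l}^{g,2}$,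 $$LEL(G)>LEL(U^0).$$ -/

import Mathlib

namespace UnicyclicLEL

open Classical in
/-- The Laplacian-like energy: the sum of the square roots of the Laplacian eigenvalues, counted
with multiplicity. The smallest Laplacian eigenvalue of any graph is `0`, so letting the sum run
over all `n` eigenvalues instead of the `n - 1` largest ones only adds `√0 = 0`. -/
noncomputable def LEL {V : Type*} [Fintype V] (G : SimpleGraph V) : ℝ :=
  ∑ v : V, Real.sqrt ((G.isHermitian_lapMatrix (R := ℝ)).eigenvalues v)

/-- The number of leaves, i.e. of vertices with exactly one neighbour. -/
noncomputable def numLeaves {V : Type*} (G : SimpleGraph V) : ℕ :=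
  {v : V | (G.neighborSet v).ncard = 1}.ncard

/-- A unicyclic graph: connected, with as many edges as vertices. -/
def IsUnicyclic {V : Type*} [Fintype V] (G : SimpleGraph V) : Prop :=
  G.Connected ∧ G.edgeSet.ncard = Fintype.card V

/-- The class of `n`-vertex unicyclic graphs with exactly `l` leaves and girth `g`. -/
structure IsUnicyclicWith {V : Type*} [Fintype V] (n l g : ℕ) (G : SimpleGraph V) : Prop where
  card_eq : Fintype.card V = n
  unicyclic : IsUnicyclic G
  leaves_eq : numLeaves G = l
  girth_eq : G.girth = g

/-- The presentation `G = C_{T_1, …, T_g}`: the graph `G` is obtained from the cycle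
`u_1 u_2 ⋯ u_g` (here `u : Fin g → V`) by attaching a tree `T_i` rooted at `u_i` to each `u_i`.
The map `τ` sends a vertex to the index of the tree that contains it, so `T_i` is the subgraph of
`G` induced on `τ ⁻¹' {i}`; the only edges between different trees are the edges
of the cycle through the roots. -/
structure IsCycleWithTrees {V : Type*} (G : SimpleGraph V) (g : ℕ)
    (u : Fin g → V) (τ : V → Fin g) : Prop where
  three_le : 3 ≤ g
  root_mem : ∀ i, τ (u i) = i
  isTree : ∀ i, (G.induce (τ ⁻¹' {i})).IsTree
  adj_iff : ∀ a b, τ a ≠ τ b →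
    (G.Adj a b ↔ a = u (τ a) ∧ b = u (τ b) ∧ (SimpleGraph.cycleGraph g).Adj (τ a) (τ b))

/-- The class `𝒰_{n,l}^{g,2}`: the `n`-vertex unicyclic graphs with `l` leaves and girth `g` of the
form `C_{T_1, …, T_g}` in which exactly two of the rooted trees `T_1, …, T_g` have more than
one vertex. -/
def IsUnicyclicTwoTrees {V : Type*} [Fintype V] (n l g : ℕ) (G : SimpleGraph V) : Prop :=
  IsUnicyclicWith n l g G ∧
    ∃ (u : Fin g → V) (τ : V → Fin g), IsCycleWithTrees G g u τ ∧
      ∃ i j : Fin g, i ≠ j ∧ 1 < (τ ⁻¹' {i}).ncard ∧ 1 < (τ ⁻¹' {j}).ncard ∧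
        ∀ k, k ≠ i → k ≠ j → (τ ⁻¹' {k}).ncard = 1

/-- The balanced starlike unicyclic graph `U_{n,l}^{g,p}` on the vertices `0, …, n - 1`
(for `3 ≤ g`, `1 ≤ l` and `g + p + l ≤ n`), each edge being listed as a pair `a < b`:
* the vertices `0, …, g - 1` form a cycle;
* the vertices `g - 1, g, …, g - 1 + p` form a path with `p` edges, which joins the cycle vertex
  `g - 1` to the centre `c = g - 1 + p` of the balanced starlike tree (they coincide if `p = 0`);
* every vertex `b > c` is joined to `b - l` if `b - l ≥ c`, and to `c` otherwise.
The vertices above `c` thus split into `l` pendent paths attached at `c`, one for each residue class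
modulo `l`, whose lengths are `⌊(n - g - p) / l⌋` or `⌈(n - g - p) / l⌉`. -/
def balancedStarlike (n l g p : ℕ) : SimpleGraph (Fin n) :=
  SimpleGraph.fromRel fun a b =>
    (a : ℕ) < b ∧
      (((b : ℕ) < g ∧ ((b : ℕ) = a + 1 ∨ ((a : ℕ) = 0 ∧ (b : ℕ) = g - 1))) ∨
        (g ≤ (b : ℕ) ∧ (b : ℕ) ≤ g - 1 + p ∧ (b : ℕ) = a + 1) ∨
        (g - 1 + p < (b : ℕ) ∧ (a : ℕ) = max (g - 1 + p) ((b : ℕ) - l)))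

end UnicyclicLEL

/-! ### From Laplacian determinants to sums of square roots. -/

namespace UnicyclicLEL
open Filter Topology

/-! A Coulson-type integral turns the claim into a comparison of determinants. Up to the factor `π`,
`√a` is the integral over `z > 0` of `log (z ^ 2 + a) - log (z ^ 2)`. For two graphs of the same
order the divergent terms cancel, so it suffices that `det (x + L(U⁰)) < det (x + L(G))` for every
`x > 0` (`sum_sqrt_lt_sum_sqrt`, `LEL_lt_LEL`).

For these determinants a rooted tree matters only through a dual number: gluing at the root is
multiplication and adding an edge below a new root is the linear map `hang`. Eliminating the trees
from the leaves inwards leaves a cycle whose vertex `u i` carries the extra weight `snd / fst` of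
its tree (`det_diagonal_add_lapMatrix`).

The strict inequality comes from the cycle. Its determinant is affine in the weight at one vertex,
with coefficients independent of the vertex; for two positive weights at different vertices there is
an additional positive product term (`exists_cycle_context`). Gluing both trees at one vertex
therefore lowers the determinant.

The glued tree is then compared with a balanced starlike one. Its contribution is a nonnegative
combination of the determinant with the root deleted and the determinant of the whole tree. Both
decrease to those of a starlike tree by sliding branches along paths (`exists_val_move`), and
balancing the legs lowers both further (`val_starlike_balancedLegs_le`). As leaf and edge counts are
preserved, the same balanced tree bounds both (`IsRootedTree.val_balancedLegs_le`). -/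

/-- A primitive of `fun z => log (z ^ 2 + a) + 2` on the positive reals. -/
noncomputable def logPrimitive (a z : ℝ) : ℝ :=
  z * Real.log (z ^ 2 + a) + 2 * (√a * Real.arctan (z / √a))

theorem hasDerivAt_logPrimitive {a z : ℝ} (ha : 0 ≤ a) (hz : 0 < z) :
    HasDerivAt (logPrimitive a) (Real.log (z ^ 2 + a) + 2) z := by
  have hpos : 0 < z ^ 2 + a := by positivity
  have h1 : HasDerivAt (fun z : ℝ => z * Real.log (z ^ 2 + a))
      (1 * Real.log (z ^ 2 + a) + z * ((2 * z) / (z ^ 2 + a))) z := by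
    have h := ((hasDerivAt_pow 2 z).add_const a).log hpos.ne'
    simp only [Nat.cast_ofNat, Nat.add_one_sub_one, pow_one] at h
    exact (hasDerivAt_id z).mul h
  have h2 : HasDerivAt (fun z : ℝ => 2 * (√a * Real.arctan (z / √a)))
      (2 * (√a * (1 / (1 + (z / √a) ^ 2) * (1 / √a)))) z :=
    ((((hasDerivAt_id z).div_const _).arctan).const_mul _).const_mul _
  refine (h1.add h2).congr_deriv ?_
  rcases ha.eq_or_lt with rfl | ha
  · simp only [Real.sqrt_zero]; field_simp; ring
  · have hs : √a ^ 2 = a := Real.sq_sqrt ha.le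
    have : 0 < √a := Real.sqrt_pos.2 ha
    rw [div_pow, hs]
    have hne : a + z ^ 2 ≠ 0 := by positivity
    field_simp
    ring

theorem tendsto_logPrimitive_zero {a : ℝ} (ha : 0 ≤ a) :
    Tendsto (logPrimitive a) (𝓝[>] 0) (𝓝 0) := by
  have h1 : Tendsto (fun z : ℝ => z * Real.log (z ^ 2 + a)) (𝓝[>] 0) (𝓝 0) := by
    rcases ha.eq_or_lt with rfl | ha
    · have : Continuous fun z : ℝ => 2 * (z * Real.log z) :=
        continuous_const.mul Real.continuous_mul_log
      have h := (this.tendsto 0).mono_left (nhdsWithin_le_nhds (s := Set.Ioi 0))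
      simp only [zero_mul, mul_zero] at h
      refine h.congr fun z => ?_
      rw [add_zero, Real.log_pow]; push_cast; ring
    · have : ContinuousAt (fun z : ℝ => z * Real.log (z ^ 2 + a)) 0 := by
        apply ContinuousAt.mul continuousAt_id
        apply ContinuousAt.log (by fun_prop)
        simpa using ha.ne'
      have h := this.tendsto.mono_left (nhdsWithin_le_nhds (s := Set.Ioi 0))
      simpa using h
  have h2 : Tendsto (fun z : ℝ => 2 * (√a * Real.arctan (z / √a))) (𝓝[>] 0) (𝓝 0) := by
    have : Continuous fun z : ℝ => 2 * (√a * Real.arctan (z / √a)) := by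
      have := Real.continuous_arctan
      fun_prop
    simpa using (this.tendsto 0).mono_left (nhdsWithin_le_nhds (s := Set.Ioi 0))
  have h := h1.add h2
  rw [add_zero] at h
  exact h

/-- The logarithmic part is squeezed between `0` and `a / z`; the arctangent tends to `π / 2` and
supplies the limit. -/
theorem tendsto_logPrimitive_atTop {a : ℝ} (ha : 0 ≤ a) :
    Tendsto (fun z => logPrimitive a z - z * Real.log (z ^ 2)) atTop (𝓝 (Real.pi * √a)) := by
  have h1 : Tendsto (fun z : ℝ => z * Real.log (z ^ 2 + a) - z * Real.log (z ^ 2)) atTop (𝓝 0) := by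
    have hu : Tendsto (fun z : ℝ => a / z) atTop (𝓝 0) := tendsto_const_nhds.div_atTop tendsto_id
    refine tendsto_of_tendsto_of_tendsto_of_le_of_le' tendsto_const_nhds hu ?_ ?_
    · filter_upwards [eventually_gt_atTop 0] with z hz
      rw [← mul_sub]
      exact mul_nonneg hz.le (sub_nonneg.2 (Real.log_le_log (by positivity) (by linarith)))
    · filter_upwards [eventually_gt_atTop 0] with z hz
      rw [← mul_sub, ← Real.log_div (by positivity) (by positivity)]
      have := Real.log_le_sub_one_of_pos (show 0 < (z ^ 2 + a) / z ^ 2 by positivity)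
      calc z * Real.log ((z ^ 2 + a) / z ^ 2) ≤ z * ((z ^ 2 + a) / z ^ 2 - 1) := by gcongr
        _ = a / z := by field_simp; ring
  have h2 : Tendsto (fun z : ℝ => 2 * (√a * Real.arctan (z / √a))) atTop (𝓝 (Real.pi * √a)) := by
    rcases ha.eq_or_lt with rfl | ha
    · simp
    · have h := (Real.tendsto_arctan_atTop.mono_right nhdsWithin_le_nhds).comp
        (tendsto_id.atTop_div_const (Real.sqrt_pos.2 ha))
      have h := (h.const_mul (√a)).const_mul 2
      rw [show Real.pi * √a = 2 * (√a * (Real.pi / 2)) by ring]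
      exact h
  have := h1.add h2
  rw [zero_add] at this
  refine this.congr fun z => ?_
  simp only [logPrimitive]; ring

/-- The difference `H` of the summed primitives has as derivative the logarithm of the ratio of the
products at `x = z ^ 2`, because equal cardinalities cancel the constants `2`. Hence `H` increases
strictly from `0` to `π` times the difference of the two sums. -/
theorem sum_sqrt_lt_sum_sqrt {ι κ : Type*} [Fintype ι] [Fintype κ]
    (hcard : Fintype.card ι = Fintype.card κ) {f : ι → ℝ} {h : κ → ℝ}
    (hf : ∀ i, 0 ≤ f i) (hh : ∀ i, 0 ≤ h i)
    (hlt : ∀ x : ℝ, 0 < x → ∏ i, (x + f i) < ∏ i, (x + h i)) :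
    ∑ i, √(f i) < ∑ i, √(h i) := by
  set H : ℝ → ℝ := fun z => ∑ i, logPrimitive (h i) z - ∑ i, logPrimitive (f i) z with hH
  have hderiv : ∀ z : ℝ, 0 < z → HasDerivAt H
      (∑ i, (Real.log (z ^ 2 + h i) + 2) - ∑ i, (Real.log (z ^ 2 + f i) + 2)) z := by
    intro z hz
    exact (HasDerivAt.fun_sum fun i _ => hasDerivAt_logPrimitive (hh i) hz).sub
      (HasDerivAt.fun_sum fun i _ => hasDerivAt_logPrimitive (hf i) hz)
  have hmono : StrictMonoOn H (Set.Ioi 0) := by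
    refine strictMonoOn_of_deriv_pos (convex_Ioi 0)
      (fun z hz => (hderiv z hz).continuousAt.continuousWithinAt) fun z hz => ?_
    rw [interior_Ioi] at hz
    have hz : 0 < z := hz
    rw [(hderiv z hz).deriv, Finset.sum_add_distrib, Finset.sum_add_distrib]
    simp only [Finset.sum_const, Finset.card_univ, hcard]
    rw [← Real.log_prod (fun i _ => by have := hh i; positivity),
      ← Real.log_prod (fun i _ => by have := hf i; positivity)]
    have := Real.log_lt_log (Finset.prod_pos fun i _ => by have := hf i; positivity)
      (hlt (z ^ 2) (by positivity))
    linarith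
  have h0 : Tendsto H (𝓝[>] 0) (𝓝 0) := by
    have := (tendsto_finsetSum Finset.univ fun i _ => tendsto_logPrimitive_zero (hh i)).sub
      (tendsto_finsetSum Finset.univ fun i _ => tendsto_logPrimitive_zero (hf i))
    simpa using this
  have hinf : Tendsto H atTop (𝓝 (∑ i, Real.pi * √(h i) - ∑ i, Real.pi * √(f i))) := by
    have := (tendsto_finsetSum Finset.univ fun i _ => tendsto_logPrimitive_atTop (hh i)).sub
      (tendsto_finsetSum Finset.univ fun i _ => tendsto_logPrimitive_atTop (hf i))
    refine this.congr fun z => ?_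
    simp only [Finset.sum_sub_distrib, Finset.sum_const, Finset.card_univ, hcard, hH]
    ring
  have h1 : 0 ≤ H 1 := by
    refine le_of_tendsto h0 ?_
    filter_upwards [Ioo_mem_nhdsGT (zero_lt_one' ℝ)] with z hz
    exact (hmono hz.1 (Set.mem_Ioi.2 one_pos) hz.2).le
  -- Limits preserve only weak inequalities, so strictness is secured between two interior points.
  have h2 : H 1 < H 2 := hmono (Set.mem_Ioi.2 one_pos) (Set.mem_Ioi.2 two_pos) one_lt_two
  have h3 : H 2 ≤ ∑ i, Real.pi * √(h i) - ∑ i, Real.pi * √(f i) := by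
    refine ge_of_tendsto hinf ?_
    filter_upwards [eventually_gt_atTop 2] with z hz
    exact (hmono (Set.mem_Ioi.2 two_pos) (Set.mem_Ioi.2 (by linarith)) hz).le
  rw [← Finset.mul_sum, ← Finset.mul_sum, ← mul_sub] at h3
  have := (mul_pos_iff_of_pos_left Real.pi_pos).1 (lt_of_le_of_lt h1 (h2.trans_le h3))
  linarith

open Classical in
theorem prod_add_eigenvalues_lapMatrix {V : Type*} [Fintype V] (G : SimpleGraph V) (x : ℝ) :
    ∏ v, (x + (G.isHermitian_lapMatrix (R := ℝ)).eigenvalues v) =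
      (Matrix.diagonal (fun _ => x) + G.lapMatrix ℝ).det := by
  have h := congrArg (Polynomial.eval (-x)) (G.isHermitian_lapMatrix (R := ℝ)).charpoly_eq
  rw [Matrix.eval_charpoly, Polynomial.eval_prod] at h
  have e : Matrix.scalar V (-x) - G.lapMatrix ℝ =
      -(Matrix.diagonal (fun _ => x) + G.lapMatrix ℝ) := by
    ext i j
    by_cases hij : i = j
    · subst hij; simp [Matrix.scalar_apply]; ring
    · simp [Matrix.scalar_apply, hij]
  rw [e, Matrix.det_neg] at h
  have e2 : ∀ v, Polynomial.eval (-x) (Polynomial.X -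
      Polynomial.C (((G.isHermitian_lapMatrix (R := ℝ)).eigenvalues v : ℝ) : ℝ)) =
      (-1) * (x + (G.isHermitian_lapMatrix (R := ℝ)).eigenvalues v) := by
    intro v; simp; ring
  simp only [RCLike.ofReal_real_eq_id, id, e2, Finset.prod_mul_distrib, Finset.prod_const,
    Finset.card_univ] at h
  exact (mul_left_cancel₀ (pow_ne_zero _ (by norm_num)) h).symm

open Classical in
theorem LEL_lt_LEL {V W : Type*} [Fintype V] [Fintype W] (G : SimpleGraph V) (H : SimpleGraph W)
    (hcard : Fintype.card V = Fintype.card W)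
    (hlt : ∀ x : ℝ, 0 < x → (Matrix.diagonal (fun _ => x) + G.lapMatrix ℝ).det <
      (Matrix.diagonal (fun _ => x) + H.lapMatrix ℝ).det) : LEL G < LEL H := by
  refine sum_sqrt_lt_sum_sqrt hcard
    (G.posSemidef_lapMatrix (R := ℝ)).eigenvalues_nonneg
    (H.posSemidef_lapMatrix (R := ℝ)).eigenvalues_nonneg fun x hx => ?_
  rw [prod_add_eigenvalues_lapMatrix, prod_add_eigenvalues_lapMatrix]
  exact hlt x hx

end UnicyclicLEL

/-! ### Rooted trees as dual numbers. -/

namespace UnicyclicLEL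
open TrivSqZeroExt

/-- Hang a rooted tree from a new root by an edge. A rooted tree `T` is encoded by the dual number
`a + bε` in which `a` is the determinant of `x + L(T)` with the row and column of the root deleted
and `x * a + b` is the determinant of `x + L(T)`. -/
def hang (x : ℝ) (p : DualNumber ℝ) : DualNumber ℝ :=
  ((1 + x) * p.fst + p.snd, x * p.fst + p.snd)

@[simp] theorem fst_hang (x : ℝ) (p : DualNumber ℝ) :
    (hang x p).fst = (1 + x) * p.fst + p.snd := rfl

@[simp] theorem snd_hang (x : ℝ) (p : DualNumber ℝ) :
    (hang x p).snd = x * p.fst + p.snd := rfl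

theorem dual_fst_mul (p q : DualNumber ℝ) : (p * q).fst = p.fst * q.fst := by simp

theorem dual_snd_mul (p q : DualNumber ℝ) :
    (p * q).snd = p.fst * q.snd + p.snd * q.fst := by simp [mul_comm]

/-- The determinant of `x + L` for a rooted tree attached to a context: `K` and `D` are determined
by what is attached at the root. -/
def val (x K D : ℝ) (p : DualNumber ℝ) : ℝ := K * p.fst + D * (x * p.fst + p.snd)

/-- The pendant path with `k` edges. -/
def pendant (x : ℝ) (k : ℕ) : DualNumber ℝ := (hang x)^[k] 1

/-- The starlike tree with leg lengths `s`, rooted at its centre. -/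
def starlike (x : ℝ) (s : Multiset ℕ) : DualNumber ℝ := (s.map (pendant x)).prod

/-- Dual numbers which encode a rooted tree with `m` edges and `l` leaves other than the root. -/
inductive IsRootedTree (x : ℝ) : DualNumber ℝ → ℕ → ℕ → Prop
  | one : IsRootedTree x 1 0 0
  | mul {p q l m l' m'} : IsRootedTree x p l m → IsRootedTree x q l' m' →
      IsRootedTree x (p * q) (l + l') (m + m')
  | hang {p l m} : IsRootedTree x p l m → IsRootedTree x (hang x p) (max l 1) (m + 1)

/-- The sign conditions satisfied by the dual number of a rooted tree for `0 < x`. -/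
def Admissible (p : DualNumber ℝ) : Prop := 0 < p.fst ∧ 0 ≤ p.snd

theorem Admissible.one : Admissible 1 := by simp [Admissible]

theorem Admissible.mul {p q : DualNumber ℝ} (hp : Admissible p) (hq : Admissible q) :
    Admissible (p * q) := by
  obtain ⟨h1, h2⟩ := hp
  obtain ⟨h3, h4⟩ := hq
  refine ⟨?_, ?_⟩
  · rw [dual_fst_mul]; positivity
  · rw [dual_snd_mul]; positivity

theorem Admissible.hang {x : ℝ} (hx : 0 < x) {p : DualNumber ℝ} (hp : Admissible p) :
    Admissible (hang x p) := by
  obtain ⟨h1, h2⟩ := hp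
  refine ⟨?_, ?_⟩
  · rw [fst_hang]; positivity
  · rw [snd_hang]; positivity

theorem Admissible.iterate_hang {x : ℝ} (hx : 0 < x) {p : DualNumber ℝ} (hp : Admissible p)
    (c : ℕ) : Admissible ((UnicyclicLEL.hang x)^[c] p) := by
  induction c with
  | zero => exact hp
  | succ c ih => rw [Function.iterate_succ_apply']; exact ih.hang hx

theorem admissible_pendant {x : ℝ} (hx : 0 < x) (k : ℕ) : Admissible (pendant x k) :=
  Admissible.one.iterate_hang hx k

theorem Admissible.prod {ι : Type*} (s : Finset ι) {f : ι → DualNumber ℝ}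
    (h : ∀ i ∈ s, Admissible (f i)) : Admissible (∏ i ∈ s, f i) :=
  Finset.prod_induction _ _ (fun _ _ => Admissible.mul) Admissible.one h

theorem admissible_starlike {x : ℝ} (hx : 0 < x) (s : Multiset ℕ) : Admissible (starlike x s) := by
  induction s using Multiset.induction with
  | empty => simpa [starlike] using Admissible.one
  | cons k s ih =>
    rw [starlike, Multiset.map_cons, Multiset.prod_cons]
    exact (admissible_pendant hx k).mul ih

theorem IsRootedTree.admissible {x : ℝ} (hx : 0 < x) {p l m} (h : IsRootedTree x p l m) :
    Admissible p := by
  induction h with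
  | one => exact .one
  | mul _ _ h1 h2 => exact h1.mul h2
  | hang _ h => exact h.hang hx

@[simp] theorem starlike_cons (x : ℝ) (k : ℕ) (s : Multiset ℕ) :
    starlike x (k ::ₘ s) = pendant x k * starlike x s := by simp [starlike]

@[simp] theorem starlike_add (x : ℝ) (s t : Multiset ℕ) :
    starlike x (s + t) = starlike x s * starlike x t := by simp [starlike]

theorem iterate_hang_pendant (x : ℝ) (c k : ℕ) :
    (hang x)^[c] (pendant x k) = pendant x (c + k) := by
  rw [pendant, pendant, Function.iterate_add_apply]

/-- A tree `q` glued at the root can be absorbed into the context. -/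
theorem val_mul (x K D : ℝ) (p q : DualNumber ℝ) :
    val x K D (p * q) = val x (K * q.fst + D * q.snd) (D * q.fst) p := by
  simp only [val, dual_fst_mul, dual_snd_mul]; ring

theorem val_hang (x K D : ℝ) (p : DualNumber ℝ) :
    val x K D (hang x p) = val x (K + x * D) (K + x * D + D) p := by
  simp only [val, fst_hang, snd_hang]; ring

theorem exists_val_iterate_hang {x K D : ℝ} (hx : 0 < x) (hK : 0 ≤ K) (hD : 0 ≤ D) (c : ℕ) :
    ∃ K' D', 0 ≤ K' ∧ 0 ≤ D' ∧ ∀ p, val x K D ((hang x)^[c] p) = val x K' D' p := by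
  induction c generalizing K D with
  | zero => exact ⟨K, D, hK, hD, fun _ => rfl⟩
  | succ c ih =>
    obtain ⟨K', D', h1, h2, h⟩ := ih (K := K + x * D) (D := K + x * D + D) (by positivity)
      (by positivity)
    exact ⟨K', D', h1, h2, fun p => by rw [Function.iterate_succ_apply', val_hang, h]⟩

/-- As a matrix, `hang x` is `M` with rows `(1 + x, 1)` and `(x, 1)`, so `M ^ 2 = (2 + x) M - 1` by
Cayley–Hamilton and `M ^ c = α + β M`. The bound on `α + β` makes the sign of `β` inductive. -/
theorem exists_iterate_hang {x : ℝ} (hx : 0 < x) (c : ℕ) :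
    ∃ α β : ℝ, 0 ≤ β ∧ 0 ≤ α + β ∧
      ∀ p, ((hang x)^[c] p).fst = (α + (1 + x) * β) * p.fst + β * p.snd ∧
        ((hang x)^[c] p).snd = x * β * p.fst + (α + β) * p.snd := by
  induction c with
  | zero => exact ⟨1, 0, by simp⟩
  | succ c ih =>
    obtain ⟨α, β, hβ, hαβ, h⟩ := ih
    refine ⟨-β, α + (2 + x) * β, ?_, ?_, fun p => ?_⟩
    · nlinarith [mul_nonneg hx.le hβ]
    · nlinarith [mul_nonneg hx.le hβ]
    · rw [Function.iterate_succ_apply', fst_hang, snd_hang, (h p).1, (h p).2]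
      constructor <;> ring

theorem _root_.Multiset.exists_cons_of_card_ne_zero {α : Type*} {s : Multiset α}
    (hs : s.card ≠ 0) : ∃ a t, s = a ::ₘ t := by
  obtain ⟨a, ha⟩ := Multiset.card_pos_iff_exists_mem.1 (Nat.pos_of_ne_zero hs)
  obtain ⟨t, ht⟩ := Multiset.exists_cons_of_mem ha
  exact ⟨a, t, ht⟩

/-! ### Sliding branches along paths until the tree is starlike. -/

/-- Moving a bunch of branches `q` along a path with `c` edges to its other end. -/
theorem exists_val_move {x : ℝ} (hx : 0 < x) (c : ℕ) :
    ∃ r : ℝ, 0 ≤ r ∧ ∀ K D p q, val x K D ((hang x)^[c] (p * q)) -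
      val x K D ((hang x)^[c] p * q) = q.snd * r * (K * p.fst - D * p.snd) := by
  obtain ⟨α, β, hβ, -, h⟩ := exists_iterate_hang hx c
  refine ⟨β, hβ, fun K D p q => ?_⟩
  simp only [val, dual_fst_mul, dual_snd_mul, (h _).1, (h _).2]
  ring

/-- With `K = 0` only the determinant of the whole tree enters, and it does not depend on which
vertex is the root. -/
theorem val_zero_reroot (x D : ℝ) (c : ℕ) (p q : DualNumber ℝ) :
    val x 0 D ((hang x)^[c] p * q) = val x 0 D (p * (hang x)^[c] q) := by
  induction c generalizing p q with
  | zero => rfl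
  | succ c ih =>
    rw [Function.iterate_succ_apply, ih, Function.iterate_succ_apply']
    simp only [val, dual_fst_mul, dual_snd_mul, fst_hang, snd_hang]
    ring

theorem val_move_le {x : ℝ} (hx : 0 < x) (c : ℕ) {K D : ℝ} {p q : DualNumber ℝ}
    (hq : Admissible q) (h : D * p.snd ≤ K * p.fst) :
    val x K D ((hang x)^[c] p * q) ≤ val x K D ((hang x)^[c] (p * q)) := by
  obtain ⟨r, hr, e⟩ := exists_val_move hx c
  have := mul_nonneg (mul_nonneg hq.2 hr) (sub_nonneg.2 h)
  rw [← e] at this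
  linarith

theorem val_move_le' {x : ℝ} (hx : 0 < x) (c : ℕ) {K D : ℝ} {p q : DualNumber ℝ}
    (hq : Admissible q) (h : K * p.fst ≤ D * p.snd) :
    val x K D ((hang x)^[c] (p * q)) ≤ val x K D ((hang x)^[c] p * q) := by
  obtain ⟨r, hr, e⟩ := exists_val_move hx c
  have := mul_nonneg (mul_nonneg hq.2 hr) (sub_nonneg.2 h)
  have e := e K D p q
  linarith

theorem IsRootedTree.eq_one {x : ℝ} {p l m} (h : IsRootedTree x p l m) (hl : l = 0) :
    p = 1 ∧ m = 0 := by
  induction h with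
  | one => exact ⟨rfl, rfl⟩
  | mul _ _ h1 h2 =>
    obtain ⟨rfl, rfl⟩ := h1 (by omega)
    obtain ⟨rfl, rfl⟩ := h2 (by omega)
    simp
  | hang => omega

/-- The branches of a starlike tree at the end of a path with `c` edges can be merged with
branches `q` at its start, either at the start or at the end. -/
theorem exists_merge {x : ℝ} (hx : 0 < x) {K D : ℝ} (hD : 0 ≤ D) (c : ℕ)
    {s : Multiset ℕ} (hs : s.card ≠ 0) {q : DualNumber ℝ} (hq : Admissible q) :
    (val x K D ((hang x)^[c] (starlike x s * q)) ≤ val x K D ((hang x)^[c] (starlike x s) * q)) ∨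
    ∃ t : Multiset ℕ, t.card = s.card ∧ t.sum = c + s.sum ∧
      val x K D (starlike x t * q) ≤ val x K D ((hang x)^[c] (starlike x s) * q) := by
  rcases le_total (K * (starlike x s).fst) (D * (starlike x s).snd) with h | h
  · exact .inl (val_move_le' hx c hq h)
  · right
    obtain ⟨k, s, rfl⟩ := Multiset.exists_cons_of_card_ne_zero hs
    -- One leg stays at the far end, where it prolongs the path to a leg of length `c + k`; the
    -- other legs slide to the start. The sign condition passes from the whole bunch to this leg
    -- because `snd / fst` is additive over branches.
    refine ⟨(c + k) ::ₘ s, by simp, by simp [add_assoc], ?_⟩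
    have h1 := admissible_pendant hx k
    have h2 := admissible_starlike hx s
    rw [starlike_cons, dual_fst_mul, dual_snd_mul] at h
    have hcmp : D * (pendant x k).snd ≤ K * (pendant x k).fst := by
      refine le_of_mul_le_mul_right ?_ h2.1
      have : 0 ≤ D * ((pendant x k).fst * (starlike x s).snd) :=
        mul_nonneg hD (mul_nonneg h1.1.le h2.2)
      linarith
    rw [val_mul, val_mul, starlike_cons, starlike_cons, ← iterate_hang_pendant]
    refine val_move_le hx c h2 ?_
    have e1 : 0 ≤ D * q.snd * (pendant x k).fst :=
      mul_nonneg (mul_nonneg hD hq.2) h1.1.le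
    have e2 := mul_le_mul_of_nonneg_right hcmp hq.1.le
    linarith

theorem exists_starlike_merge_starlike {x : ℝ} (hx : 0 < x) {K D : ℝ} (hD : 0 ≤ D)
    (c : ℕ) {s : Multiset ℕ} (hs : s.card ≠ 0) (t : Multiset ℕ) :
    ∃ (c' : ℕ) (s' : Multiset ℕ), s'.card = s.card + t.card ∧ c' + s'.sum = c + s.sum + t.sum ∧
      val x K D ((hang x)^[c'] (starlike x s')) ≤
        val x K D ((hang x)^[c] (starlike x s) * starlike x t) := by
  rcases exists_merge hx hD c hs (admissible_starlike hx t) with h | ⟨s', h1, h2, h⟩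
  · exact ⟨c, s + t, by simp, by simp [add_assoc], by rwa [starlike_add]⟩
  · exact ⟨0, s' + t, by simp [h1], by simp [h2], by simpa [starlike_add] using h⟩

/-- Two applications of `exists_merge`: the first removes one of the two paths or carries the second
branch to the far end of the first, and the second removes the branching that remains. -/
theorem exists_starlike_merge {x : ℝ} (hx : 0 < x) {K D : ℝ} (hK : 0 ≤ K) (hD : 0 ≤ D)
    (c d : ℕ) {s t : Multiset ℕ} (hs : s.card ≠ 0) (ht : t.card ≠ 0) :
    ∃ (c' : ℕ) (s' : Multiset ℕ), s'.card = s.card + t.card ∧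
      c' + s'.sum = c + s.sum + (d + t.sum) ∧
      val x K D ((hang x)^[c'] (starlike x s')) ≤
        val x K D ((hang x)^[c] (starlike x s) * (hang x)^[d] (starlike x t)) := by
  rcases exists_merge hx hD c hs ((admissible_starlike hx t).iterate_hang hx d)
    with h | ⟨s', h1, h2, h⟩
  · obtain ⟨K', D', -, hD', e⟩ := exists_val_iterate_hang hx hK hD c
    obtain ⟨c', s', h1, h2, h3⟩ := exists_starlike_merge_starlike hx hD' d ht s
    refine ⟨c + c', s', by omega, by omega, ?_⟩
    rw [Function.iterate_add_apply, e]
    rw [e, mul_comm (starlike x s)] at h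
    exact h3.trans h
  · obtain ⟨c', s'', h3, h4, h5⟩ := exists_starlike_merge_starlike hx hD d ht s'
    rw [mul_comm (starlike x s')] at h
    exact ⟨c', s'', by omega, by omega, h5.trans h⟩

/-- In any context, a rooted tree can be replaced by a starlike tree whose centre is joined to the
root by a path. -/
theorem IsRootedTree.exists_starlike {x : ℝ} (hx : 0 < x) {p l m} (h : IsRootedTree x p l m)
    (hl : l ≠ 0) {K D : ℝ} (hK : 0 ≤ K) (hD : 0 ≤ D) :
    ∃ (c : ℕ) (s : Multiset ℕ), s.card = l ∧ c + s.sum = m ∧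
      val x K D ((UnicyclicLEL.hang x)^[c] (starlike x s)) ≤ val x K D p := by
  induction h generalizing K D with
  | one => exact absurd rfl hl
  | @hang p l m h ih =>
    rcases eq_or_ne l 0 with rfl | hl
    · obtain ⟨rfl, rfl⟩ := h.eq_one rfl
      exact ⟨0, {1}, by simp, by simp, by simp [starlike, pendant]⟩
    · obtain ⟨c, s, h1, h2, h3⟩ := ih hl (K := K + x * D) (D := K + x * D + D) (by positivity)
        (by positivity)
      refine ⟨c + 1, s, by omega, by omega, ?_⟩
      rwa [Function.iterate_succ_apply', val_hang, val_hang]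
  | @mul p q l m l' m' hp hq ihp ihq =>
    rcases eq_or_ne l 0 with rfl | hl
    · obtain ⟨rfl, rfl⟩ := hp.eq_one rfl
      simpa using ihq (by omega) hK hD
    rcases eq_or_ne l' 0 with rfl | hl'
    · obtain ⟨rfl, rfl⟩ := hq.eq_one rfl
      simpa using ihp (by omega) hK hD
    have context : ∀ r, Admissible r → 0 ≤ K * r.fst + D * r.snd ∧ 0 ≤ D * r.fst := by
      intro r hr
      have := hr.1.le
      have := hr.2
      constructor <;> positivity
    obtain ⟨k1, k2⟩ := context q (hq.admissible hx)
    obtain ⟨c, s, hs, hm, h1⟩ := ihp hl k1 k2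
    rw [← val_mul, ← val_mul, mul_comm _ q, mul_comm _ q] at h1
    have hcs := (admissible_starlike hx s).iterate_hang hx c
    obtain ⟨k1, k2⟩ := context _ hcs
    obtain ⟨d, t, ht, hm', h2⟩ := ihq hl' k1 k2
    rw [← val_mul, ← val_mul] at h2
    have h12 := h2.trans h1
    rw [mul_comm p q]
    obtain ⟨c', s', h3, h4, h5⟩ := exists_starlike_merge hx hK hD d c (by omega : t.card ≠ 0)
      (by omega : s.card ≠ 0)
    exact ⟨c', s', by omega, by omega, h5.trans h12⟩

/-- The determinant with the root deleted is at least that of some starlike tree. -/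
theorem IsRootedTree.exists_starlike_fst_le {x : ℝ} (hx : 0 < x) {p l m}
    (h : IsRootedTree x p l m) (hl : l ≠ 0) :
    ∃ s : Multiset ℕ, s.card = l ∧ s.sum = m ∧ (starlike x s).fst ≤ p.fst := by
  obtain ⟨c, s, hs, hm, h1⟩ := h.exists_starlike hx hl zero_le_one le_rfl
  obtain ⟨k, s, rfl⟩ := Multiset.exists_cons_of_card_ne_zero (hs.trans_ne hl)
  refine ⟨(c + k) ::ₘ s, by simpa using hs, by simp at hm ⊢; omega, ?_⟩
  -- For `D = 0` the sign condition is automatic, so branches may always slide to the root.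
  have h2 := val_move_le hx c (K := 1) (D := 0) (p := pendant x k) (admissible_starlike hx s)
    (by simpa using (admissible_pendant hx k).1.le)
  rw [starlike_cons] at h1
  have h3 := h2.trans h1
  simpa [val, iterate_hang_pendant] using h3

/-- The determinant of the whole tree is at least that of some starlike tree, if the root is not
an end vertex. -/
theorem IsRootedTree.exists_starlike_det_le {x : ℝ} (hx : 0 < x) {p q l l' m m'}
    (hp : IsRootedTree x p l m) (hq : IsRootedTree x q l' m') (hl : l ≠ 0) (hl' : l' ≠ 0) :
    ∃ s : Multiset ℕ, s.card = l + l' ∧ s.sum = m + m' ∧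
      val x 0 1 (starlike x s) ≤ val x 0 1 (p * q) := by
  have context : ∀ r, Admissible r → 0 ≤ 0 * r.fst + 1 * r.snd ∧ 0 ≤ 1 * r.fst := by
    intro r hr
    have := hr.1.le
    have := hr.2
    constructor <;> linarith
  obtain ⟨k1, k2⟩ := context q (hq.admissible hx)
  obtain ⟨c, s, hs, hm, h1⟩ := hp.exists_starlike hx hl k1 k2
  rw [← val_mul, ← val_mul, mul_comm _ q, mul_comm _ q] at h1
  obtain ⟨k1, k2⟩ := context _ ((admissible_starlike hx s).iterate_hang hx c)
  obtain ⟨d, t, ht, hm', h2⟩ := hq.exists_starlike hx hl' k1 k2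
  rw [← val_mul, ← val_mul] at h2
  have h12 := h2.trans h1
  rw [mul_comm p q]
  -- The two paths form a single one of length `c + d` between two starlike centres. The following
  -- comparison decides which centre gives up all but one of its legs.
  rw [← val_zero_reroot, ← Function.iterate_add_apply] at h12
  obtain ⟨j, t, rfl⟩ := Multiset.exists_cons_of_card_ne_zero (ht.trans_ne hl')
  obtain ⟨k, s, rfl⟩ := Multiset.exists_cons_of_card_ne_zero (hs.trans_ne hl)
  obtain ⟨k1, k2⟩ := context _ (admissible_starlike hx (k ::ₘ s))
  rcases le_total
    ((1 * (starlike x (k ::ₘ s)).fst) * (pendant x j).snd)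
    ((0 * (starlike x (k ::ₘ s)).fst + 1 * (starlike x (k ::ₘ s)).snd) * (pendant x j).fst)
    with h | h
  · refine ⟨(c + d + j) ::ₘ (t + k ::ₘ s), by simp at hs ht ⊢; omega,
      by simp at hm hm' ⊢; omega, ?_⟩
    have h3 := val_move_le hx (c + d) (admissible_starlike hx t) h
    rw [← val_mul, ← val_mul, ← starlike_cons, iterate_hang_pendant, mul_assoc, ← starlike_add,
      ← starlike_cons] at h3
    exact h3.trans h12
  · refine ⟨(c + d + k) ::ₘ (j ::ₘ t + s), by simp at hs ht ⊢; omega,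
      by simp at hm hm' ⊢; omega, ?_⟩
    have hk := admissible_pendant hx k
    have hj := admissible_pendant hx j
    have hs := admissible_starlike hx s
    have ht := admissible_starlike hx t
    have h3 := val_move_le' hx (c + d) (K := 0 * (pendant x k).fst + 1 * (pendant x k).snd)
      (D := 1 * (pendant x k).fst) (p := starlike x (j ::ₘ t)) hs ?_
    · rw [← val_mul, ← val_mul, val_zero_reroot, mul_assoc, mul_comm (starlike x s),
        mul_comm (starlike x (j ::ₘ t)), mul_assoc, iterate_hang_pendant, ← starlike_add,
        ← starlike_cons, mul_assoc, mul_comm (starlike x s), ← starlike_cons,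
        add_comm s] at h3
      exact h3.trans h12
    · simp only [starlike_cons, dual_fst_mul, dual_snd_mul, zero_mul, zero_add, one_mul] at h ⊢
      have e : (pendant x k).snd * (pendant x j).fst ≤ (pendant x k).fst * (pendant x j).snd := by
        refine le_of_mul_le_mul_right ?_ hs.1
        have : 0 ≤ (pendant x k).fst * (starlike x s).snd * (pendant x j).fst :=
          mul_nonneg (mul_nonneg hk.1.le hs.2) hj.1.le
        linarith
      have e1 := mul_le_mul_of_nonneg_right e ht.1.le
      have : 0 ≤ (pendant x k).fst * ((pendant x j).fst * (starlike x t).snd) :=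
        mul_nonneg hk.1.le (mul_nonneg hj.1.le ht.2)
      linarith

/-! ### Balancing the legs. -/

/-- The multiset of `l` natural numbers with sum `m` in which any two entries differ by at most
one. -/
def balancedLegs (l m : ℕ) : Multiset ℕ :=
  Multiset.replicate (l - m % l) (m / l) + Multiset.replicate (m % l) (m / l + 1)

/-- A Cassini identity: the left side does not depend on `j`, since `hang x` has determinant one. -/
theorem fst_pendant_mul_fst_pendant (x : ℝ) (i j : ℕ) :
    (pendant x (j + i + 2)).fst * (pendant x j).fst -
      (pendant x (j + i + 1)).fst * (pendant x (j + 1)).fst = (pendant x (i + 1)).snd := by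
  have hf : ∀ k, (pendant x (k + 1)).fst = (1 + x) * (pendant x k).fst + (pendant x k).snd :=
    fun k => by rw [pendant, Function.iterate_succ_apply']; rfl
  have hs : ∀ k, (pendant x (k + 1)).snd = x * (pendant x k).fst + (pendant x k).snd :=
    fun k => by rw [pendant, Function.iterate_succ_apply']; rfl
  induction j with
  | zero => 
    have h0 : (pendant x 0).fst = 1 := by simp [pendant]
    have h0' : (pendant x 0).snd = 0 := by simp [pendant]
    simp only [zero_add, hf, hs, h0, h0']
    ring
  | succ j ih =>
    rw [← ih, show j + 1 + i + 2 = (j + i + 1) + 1 + 1 by ring,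
      show j + i + 2 = (j + i + 1) + 1 by ring, show j + 1 + i + 1 = (j + i + 1) + 1 by ring]
    simp only [hf, hs]
    ring

/-- Moving one edge between two legs leaves the path they form, hence its determinant, unchanged.
Only the determinant with the centre deleted varies, and the Cassini identity gives its sign. -/
theorem val_pendant_mul_pendant_le {x : ℝ} (hx : 0 < x) {K D : ℝ} (hK : 0 ≤ K) (hD : 0 ≤ D)
    {i j : ℕ} (hij : j + 2 ≤ i) {q : DualNumber ℝ} (hq : Admissible q) :
    val x K D (pendant x (i - 1) * pendant x (j + 1) * q) ≤
      val x K D (pendant x i * pendant x j * q) := by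
  obtain ⟨i, rfl⟩ := Nat.exists_eq_add_of_le hij
  have e := fst_pendant_mul_fst_pendant x i j
  have hpos := (admissible_pendant hx (i + 1)).2
  rw [show j + i + 2 = j + 2 + i by ring, show j + i + 1 = j + 2 + i - 1 by omega] at e
  have hdet : val x 0 1 (pendant x (j + 2 + i - 1) * pendant x (j + 1)) =
      val x 0 1 (pendant x (j + 2 + i) * pendant x j) := by
    have := val_zero_reroot x 1 1 (pendant x (j + 2 + i - 1)) (pendant x j)
    rw [iterate_hang_pendant, iterate_hang_pendant, show 1 + (j + 2 + i - 1) = j + 2 + i by omega,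
      add_comm 1 j] at this
    exact this.symm
  rw [val_mul x K D, val_mul x K D]
  have k1 : 0 ≤ K * q.fst + D * q.snd :=
    add_nonneg (mul_nonneg hK hq.1.le) (mul_nonneg hD hq.2)
  generalize K * q.fst + D * q.snd = K' at k1
  generalize D * q.fst = D'
  have split : ∀ p, val x K' D' p = K' * p.fst + D' * val x 0 1 p := by
    intro p; simp only [val]; ring
  rw [split, split, hdet, dual_fst_mul, dual_fst_mul]
  have := mul_nonneg k1 hpos
  rw [← e] at this
  linarith

theorem eq_balancedLegs {s : Multiset ℕ} (h : ∀ i ∈ s, ∀ j ∈ s, i ≤ j + 1) :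
    s = balancedLegs s.card s.sum := by
  rcases Multiset.empty_or_exists_mem s with rfl | ⟨a, ha⟩
  · simp [balancedLegs]
  obtain ⟨b, hb, hmin⟩ : ∃ b ∈ s, ∀ i ∈ s, b ≤ i := by
    have hne : {i | i ∈ s}.Nonempty := ⟨a, ha⟩
    exact ⟨sInf {i | i ∈ s}, Nat.sInf_mem hne, fun i hi => Nat.sInf_le hi⟩
  have hs : s = Multiset.replicate (s.count b) b + Multiset.replicate (s.card - s.count b) (b + 1) := by
    have h1 := Multiset.filter_add_not (fun i => b = i) s
    rw [Multiset.filter_eq s b] at h1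
    have h2 : Multiset.filter (fun i => ¬b = i) s =
        Multiset.replicate (s.card - s.count b) (b + 1) := by
      rw [Multiset.eq_replicate]
      refine ⟨?_, fun i hi => ?_⟩
      · have := congrArg Multiset.card h1
        simp only [Multiset.card_add, Multiset.card_replicate] at this
        omega
      · rw [Multiset.mem_filter] at hi
        have := h i hi.1 b hb
        have := hmin i hi.1
        omega
    rw [h2] at h1
    exact h1.symm
  have hle := Multiset.count_le_card b s
  have hpos := Multiset.count_pos.2 hb
  set k := s.count b with hk
  set l := s.card with hl
  have hsum : s.sum = l * b + (l - k) := by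
    rw [hs, Multiset.sum_add, Multiset.sum_replicate, Multiset.sum_replicate]
    simp only [smul_eq_mul]
    obtain ⟨c, hc⟩ := Nat.exists_eq_add_of_le hle
    rw [hc, Nat.add_sub_cancel_left]; ring
  -- The minimum `b` is attained, so the number of longer legs is a genuine remainder modulo `l`.
  have hlt : l - k < l := by omega
  have hmod : s.sum % l = l - k := by
    rw [hsum, Nat.mul_add_mod, Nat.mod_eq_of_lt hlt]
  have hdiv : s.sum / l = b := by
    rw [hsum, Nat.mul_add_div (by omega), Nat.div_eq_of_lt hlt, add_zero]
  rw [balancedLegs, hmod, hdiv, show l - (l - k) = k by omega]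
  exact hs

/-- Each transfer of an edge from a leg to one shorter by at least two decreases the sum of squares,
so the process ends in a balanced multiset. -/
theorem val_starlike_balancedLegs_le {x : ℝ} (hx : 0 < x) {K D : ℝ} (hK : 0 ≤ K) (hD : 0 ≤ D)
    (s : Multiset ℕ) :
    val x K D (starlike x (balancedLegs s.card s.sum)) ≤ val x K D (starlike x s) := by
  induction hn : (s.map (· ^ 2)).sum using Nat.strong_induction_on generalizing s with
  | _ n ih =>
    by_cases h : ∀ i ∈ s, ∀ j ∈ s, i ≤ j + 1
    · rw [← eq_balancedLegs h]
    · push Not at h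
      obtain ⟨i, hi, j, hj, hij⟩ := h
      obtain ⟨s, rfl⟩ := Multiset.exists_cons_of_mem hi
      obtain ⟨s, rfl⟩ := Multiset.exists_cons_of_mem
        ((Multiset.mem_cons.1 hj).resolve_left (by omega))
      have h1 := ih _ ?_ ((i - 1) ::ₘ (j + 1) ::ₘ s) rfl
      · refine le_trans (le_of_eq ?_) (h1.trans ?_)
        · rw [show ((i - 1) ::ₘ (j + 1) ::ₘ s).sum = (i ::ₘ j ::ₘ s).sum by
            simp only [Multiset.sum_cons]; omega]
          simp
        · simp only [starlike_cons, ← mul_assoc]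
          exact val_pendant_mul_pendant_le hx hK hD (by omega) (admissible_starlike hx s)
      · rw [← hn]
        obtain ⟨i, rfl⟩ := Nat.exists_eq_add_of_lt hij
        simp only [Multiset.map_cons, Multiset.sum_cons, ← add_assoc]
        rw [show j + 1 + i + 1 - 1 = j + 1 + i by omega]
        nlinarith

/-- Among rooted trees with two nontrivial branches at the root, the balanced starlike tree is
optimal. -/
theorem IsRootedTree.val_balancedLegs_le {x : ℝ} (hx : 0 < x) {K D : ℝ} (hK : 0 ≤ K) (hD : 0 ≤ D)
    {p q l l' m m'} (hp : IsRootedTree x p l m) (hq : IsRootedTree x q l' m') (hl : l ≠ 0)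
    (hl' : l' ≠ 0) :
    val x K D (starlike x (balancedLegs (l + l') (m + m'))) ≤ val x K D (p * q) := by
  -- The two extreme contexts may give different starlike trees `s` and `t`, but these have the same
  -- balanced form.
  have split : ∀ p, val x K D p = K * val x 1 0 p + D * val x 0 1 p := by
    intro p; simp only [val]; ring
  rw [split, split]
  obtain ⟨s, h1, h2, h3⟩ := (hp.mul hq).exists_starlike_fst_le hx (by omega)
  obtain ⟨t, h4, h5, h6⟩ := hp.exists_starlike_det_le hx hq hl hl'
  have h7 := val_starlike_balancedLegs_le hx zero_le_one le_rfl s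
  have h8 := val_starlike_balancedLegs_le hx le_rfl zero_le_one t
  rw [h1, h2] at h7
  rw [h4, h5] at h8
  have h9 : val x 1 0 (starlike x s) ≤ val x 1 0 (p * q) := by simpa only [val, one_mul, zero_mul, add_zero] using h3
  gcongr
  · exact h7.trans h9
  · exact h8.trans h6

end UnicyclicLEL

/-! ### Weighted Laplacian determinants and the cycle. -/

namespace UnicyclicLEL
open Matrix

/-- Shrinking the off-diagonal entries to zero keeps strict diagonal dominance, so the determinant
never vanishes and keeps the sign of the product of the diagonal. -/
theorem det_pos_of_sum_row_lt_diag {n : Type*} [Fintype n] [DecidableEq n] {A : Matrix n n ℝ}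
    (h : ∀ k, ∑ j ∈ Finset.univ.erase k, |A k j| < A k k) : 0 < A.det := by
  have hdiag : ∀ k, 0 < A k k := fun k =>
    (Finset.sum_nonneg fun _ _ => abs_nonneg _).trans_lt (h k)
  let B : ℝ → Matrix n n ℝ := fun t => Matrix.of fun i j => if i = j then A i i else t * A i j
  have hcont : Continuous fun t => (B t).det := by
    refine Continuous.matrix_det (continuous_matrix fun i j => ?_)
    by_cases hij : i = j
    · simp only [B, of_apply, hij, if_true]; fun_prop
    · simp only [B, of_apply, hij, if_false]; fun_prop
  have h0 : 0 < (B 0).det := by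
    have : B 0 = diagonal fun i => A i i := by
      ext i j
      by_cases hij : i = j <;> simp [B, hij]
    rw [this, det_diagonal]
    exact Finset.prod_pos fun i _ => hdiag i
  have h1 : B 1 = A := by
    ext i j
    by_cases hij : i = j <;> simp [B, hij]
  rw [← h1]
  by_contra! hneg
  obtain ⟨t, ht, hz⟩ := intermediate_value_Icc' zero_le_one hcont.continuousOn ⟨hneg, h0.le⟩
  refine det_ne_zero_of_sum_row_lt_diag (A := B t) (fun k => ?_) hz
  refine lt_of_le_of_lt ?_ ((h k).trans_eq (by simp [B, abs_of_pos (hdiag k)]))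
  refine Finset.sum_le_sum fun j hj => ?_
  have hkj : k ≠ j := (Finset.ne_of_mem_erase hj).symm
  simp only [B, of_apply, hkj, if_false, Real.norm_eq_abs, abs_mul, abs_of_nonneg ht.1]
  exact mul_le_of_le_one_left (abs_nonneg _) ht.2

section Lap
variable {n : Type*} [Fintype n] [DecidableEq n] (G : SimpleGraph n) [DecidableRel G.Adj]

theorem lapMatrix_apply_self (k : n) : G.lapMatrix ℝ k k = G.degree k := by
  simp [SimpleGraph.lapMatrix, SimpleGraph.degMatrix]

theorem lapMatrix_apply_ne {k j : n} (h : k ≠ j) :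
    G.lapMatrix ℝ k j = -(if G.Adj k j then 1 else 0) := by
  simp [SimpleGraph.lapMatrix, SimpleGraph.degMatrix, h, SimpleGraph.adjMatrix_apply]

theorem sum_abs_lapMatrix (w : n → ℝ) (k : n) :
    ∑ j ∈ Finset.univ.erase k, |(diagonal w + G.lapMatrix ℝ) k j| = G.degree k := by
  rw [SimpleGraph.degree_eq_sum_if_adj]
  refine Eq.trans ?_ (Finset.sum_erase (a := k) Finset.univ (by simp))
  refine Finset.sum_congr rfl fun j hj => ?_
  have hkj : k ≠ j := (Finset.ne_of_mem_erase hj).symm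
  rw [Matrix.add_apply, diagonal_apply_ne _ hkj, lapMatrix_apply_ne _ hkj]
  split_ifs <;> simp

theorem det_diagonal_add_lapMatrix_pos {w : n → ℝ} (hw : ∀ k, 0 < w k) :
    0 < (diagonal w + G.lapMatrix ℝ).det := by
  refine det_pos_of_sum_row_lt_diag fun k => ?_
  rw [sum_abs_lapMatrix, Matrix.add_apply, diagonal_apply_eq, lapMatrix_apply_self]
  linarith [hw k]

theorem det_update_diagonal (A : Matrix n n ℝ) (w : n → ℝ) (i : n) (s : ℝ) :
    (diagonal (Function.update w i (w i + s)) + A).det =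
      (diagonal w + A).det + s * ((diagonal w + A).updateRow i (Pi.single i 1)).det := by
  have : diagonal (Function.update w i (w i + s)) + A =
      (diagonal w + A).updateRow i ((diagonal w + A) i + s • Pi.single i 1) := by
    ext a b
    rcases eq_or_ne a i with rfl | ha
    · rcases eq_or_ne b a with rfl | hb
      · simp; ring
      · simp [hb, hb.symm]
    · simp [updateRow_ne ha, diagonal_apply, Function.update_of_ne ha]
  rw [this, det_updateRow_add, det_updateRow_smul, updateRow_eq_self]

theorem det_update_diagonal_updateRow (A : Matrix n n ℝ) (w : n → ℝ) {i j : n} (hij : i ≠ j)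
    (s : ℝ) :
    ((diagonal (Function.update w i (w i + s)) + A).updateRow j (Pi.single j 1)).det =
      ((diagonal w + A).updateRow j (Pi.single j 1)).det +
        s * (((diagonal w + A).updateRow j (Pi.single j 1)).updateRow i (Pi.single i 1)).det := by
  have : (diagonal (Function.update w i (w i + s)) + A).updateRow j (Pi.single j 1) =
      ((diagonal w + A).updateRow j (Pi.single j 1)).updateRow i
        (((diagonal w + A).updateRow j (Pi.single j 1)) i + s • Pi.single i 1) := by
    ext a b
    rcases eq_or_ne a i with rfl | ha
    · rcases eq_or_ne b a with rfl | hb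
      · simp [updateRow_ne hij]; ring
      · simp [updateRow_ne hij, hb, hb.symm]
    · rcases eq_or_ne a j with rfl | haj
      · simp [updateRow_ne ha]
      · simp [updateRow_ne ha, updateRow_ne haj, diagonal_apply, Function.update_of_ne ha]
  rw [this, det_updateRow_add, det_updateRow_smul, updateRow_eq_self]

theorem det_updateRow_single_pos {w : n → ℝ} (hw : ∀ k, 0 < w k) (i : n) :
    0 < ((diagonal w + G.lapMatrix ℝ).updateRow i (Pi.single i 1)).det := by
  refine det_pos_of_sum_row_lt_diag fun k => ?_
  rcases eq_or_ne k i with rfl | hk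
  · rw [Finset.sum_eq_zero fun j hj => by simp [Finset.ne_of_mem_erase hj]]
    simp
  · simp only [updateRow_ne hk]
    rw [sum_abs_lapMatrix, Matrix.add_apply, diagonal_apply_eq, lapMatrix_apply_self]
    linarith [hw k]

theorem det_updateRow_single_updateRow_single_pos {w : n → ℝ} (hw : ∀ k, 0 < w k) (i j : n) :
    0 < (((diagonal w + G.lapMatrix ℝ).updateRow j (Pi.single j 1)).updateRow i
      (Pi.single i 1)).det := by
  refine det_pos_of_sum_row_lt_diag fun k => ?_
  rcases eq_or_ne k i with rfl | hk
  · rw [Finset.sum_eq_zero fun j hj => by simp [Finset.ne_of_mem_erase hj]]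
    simp
  · simp only [updateRow_ne hk]
    rcases eq_or_ne k j with rfl | hk
    · rw [Finset.sum_eq_zero fun j hj => by simp [Finset.ne_of_mem_erase hj]]
      simp
    · simp only [updateRow_ne hk]
      rw [sum_abs_lapMatrix, Matrix.add_apply, diagonal_apply_eq, lapMatrix_apply_self]
      linarith [hw k]

end Lap

/-- The Laplacian matrix of a cycle with `w` added to the diagonal. -/
noncomputable def cycleMatrix (g : ℕ) (w : Fin g → ℝ) : Matrix (Fin g) (Fin g) ℝ :=
  diagonal w + (SimpleGraph.cycleGraph g).lapMatrix ℝ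

theorem cycleMatrix_rotate (n : ℕ) (w : Fin (n + 3) → ℝ) (d : Fin (n + 3)) :
    (cycleMatrix (n + 3) fun k => w (k + d)).det = (cycleMatrix (n + 3) w).det := by
  rw [← det_submatrix_equiv_self (Equiv.addRight d) (cycleMatrix (n + 3) w)]
  congr 1
  ext a b
  rcases eq_or_ne a b with rfl | hab
  · simp [cycleMatrix, lapMatrix_apply_self, SimpleGraph.cycleGraph_degree_three_le]
  · simp [cycleMatrix, lapMatrix_apply_ne, hab, SimpleGraph.cycleGraph_eq_circulantGraph]

/-- Adding weight at one vertex of a cycle changes the determinant affinely, and in the same way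
for all vertices; spreading the weight over two vertices gives a larger determinant. -/
theorem exists_cycle_context {g : ℕ} (hg : 3 ≤ g) {x : ℝ} (hx : 0 < x) :
    ∃ K D : ℝ, 0 ≤ K ∧ 0 < D ∧
      (∀ k s, (cycleMatrix g (Function.update (fun _ => x) k (x + s))).det = K + D * (x + s)) ∧
      ∀ i j s t, i ≠ j → 0 < s → 0 < t → K + D * (x + s + t) <
        (cycleMatrix g (Function.update (Function.update (fun _ => x) i (x + s)) j (x + t))).det := by
  obtain ⟨n, rfl⟩ := Nat.exists_eq_add_of_le' hg
  set L := (SimpleGraph.cycleGraph (n + 3)).lapMatrix ℝ with hL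
  set m : Fin (n + 3) → ℝ := fun k =>
    ((diagonal (fun _ => x) + L).updateRow k (Pi.single k 1)).det with hm
  set C := (cycleMatrix (n + 3) fun _ => x).det with hC
  have hsingle : ∀ k s, (cycleMatrix (n + 3) (Function.update (fun _ => x) k (x + s))).det =
      C + s * m k := fun k s => det_update_diagonal L (fun _ => x) k s
  -- Rotational symmetry of the cycle makes the slope the same at all vertices.
  have hrot : ∀ k, m k = m 0 := by
    intro k
    have h := cycleMatrix_rotate n (Function.update (fun _ => x) k (x + 1)) k
    have e : (fun a => Function.update (fun _ => x) k (x + 1) (a + k)) =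
        Function.update (fun _ : Fin (n + 3) => x) 0 (x + 1) := by
      ext a
      simp [Function.update_apply]
    rw [e, hsingle, hsingle] at h
    linarith
  have hmpos : 0 < m 0 := det_updateRow_single_pos _ (fun _ => hx) 0
  refine ⟨C - x * m 0, m 0, ?_, hmpos, fun k s => ?_, fun i j s t hij hs ht => ?_⟩
  · by_contra! hneg
    -- If the constant term were negative, the affine function would vanish at a positive weight,
    -- contradicting diagonal dominance.
    have h := hsingle 0 (-x + (x * m 0 - C) / m 0)
    have hpos : 0 < (x * m 0 - C) / m 0 := div_pos (by linarith) hmpos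
    have : 0 < (cycleMatrix (n + 3) (Function.update (fun _ => x) 0
        (x + (-x + (x * m 0 - C) / m 0)))).det := by
      refine det_diagonal_add_lapMatrix_pos _ fun k => ?_
      rcases eq_or_ne k 0 with rfl | hk
      · simpa using hpos
      · simpa [Function.update_of_ne hk] using hx
    rw [h] at this
    have e : (x * m 0 - C) / m 0 * m 0 = x * m 0 - C := by field_simp
    rw [add_mul, e] at this
    linarith
  · rw [hsingle, hrot]; ring
  · set w := Function.update (fun _ : Fin (n + 3) => x) i (x + s) with hw
    have hwj : w j = x := by simp [hw, Function.update_of_ne hij.symm]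
    have h1 := det_update_diagonal L w j t
    have h2 := det_update_diagonal_updateRow L (fun _ => x) hij s
    have h3 := hsingle i s
    -- This term, `s * t` times the determinant with both vertices deleted, is the source of
    -- strictness.
    have h4 := mul_pos hs (mul_pos ht (det_updateRow_single_updateRow_single_pos
      (SimpleGraph.cycleGraph (n + 3)) (w := fun _ => x) (fun _ => hx) i j))
    rw [hwj, h2] at h1
    have h5 := hrot i
    have h6 := hrot j
    simp only [cycleMatrix, ← hL, ← hw] at h1 h3 ⊢
    simp only [hm] at h5 h6 h3 ⊢
    rw [h1, h3]
    rw [← hL] at h4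
    rw [h5, h6]
    linarith

end UnicyclicLEL

/-! ### Eliminating the trees from the determinant. -/

namespace UnicyclicLEL
open Matrix

/-- A presentation of a graph as a cycle `u` with rooted trees attached to it: `par` sends
each vertex outside the cycle to its parent, and `rank` witnesses that `par` is acyclic. -/
structure IsCycleForest {V : Type*} (G : SimpleGraph V) {g : ℕ} (u : Fin g → V)
    (par : V → Option V) (rank : V → ℕ) : Prop where
  injective : Function.Injective u
  par_eq_none : ∀ v, par v = none ↔ v ∈ Set.range u
  rank_lt : ∀ c v, par c = some v → rank v < rank c
  adj_iff : ∀ a b, G.Adj a b ↔ par a = some b ∨ par b = some a ∨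
    ∃ i j, u i = a ∧ u j = b ∧ (SimpleGraph.cycleGraph g).Adj i j

section Fold
variable {V : Type*} [Fintype V] [DecidableEq V] {par : V → Option V} {rank : V → ℕ}

/-- Recursion from the leaves towards the cycle; it is well-founded because `V` is finite. Used for
the dual numbers and, additively, for the leaf and edge counts. -/
theorem exists_fold (hr : ∀ c v, par c = some v → rank v < rank c) {α : Type*} [CommMonoid α]
    (op : α → α) : ∃ f : V → α, ∀ v, f v = ∏ c with par c = some v, op (f c) := by
  have wf : WellFounded fun c v : V => rank v < rank c :=
    (Finite.wellFounded_of_trans_of_irrefl (InvImage (· > ·) rank))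
  refine ⟨wf.fix fun v F => ∏ c : {c // par c = some v}, op (F c.1 (hr _ _ c.2)), fun v => ?_⟩
  rw [wf.fix_eq]
  exact (Finset.prod_subtype (Finset.univ.filter fun c => par c = some v) (by simp) fun c =>
    op (wf.fix (fun v F => ∏ c : {c // par c = some v}, op (F c.1 (hr _ _ c.2))) c)).symm

omit [DecidableEq V] in
theorem forest_induction (hr : ∀ c v, par c = some v → rank v < rank c) {P : V → Prop}
    (h : ∀ v, (∀ c, par c = some v → P c) → P v) (v : V) : P v := by
  have wf : WellFounded fun c v : V => rank v < rank c :=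
    (Finite.wellFounded_of_trans_of_irrefl (InvImage (· > ·) rank))
  exact wf.induction v fun v ih => h v fun c hc => ih c (hr c v hc)

theorem prod_prod_children {α : Type*} [CommMonoid α] (par : V → Option V) (h : V → α) :
    ∏ v, ∏ c with par c = some v, h c = ∏ c with par c ≠ none, h c := by
  simp only [Finset.prod_filter]
  rw [Finset.prod_comm]
  refine Finset.prod_congr rfl fun c _ => ?_
  rcases hc : par c with _ | v
  · simp
  · simp

theorem prod_roots {α : Type*} [CommMonoid α] {G : SimpleGraph V} {g : ℕ} {u : Fin g → V}
    (hG : IsCycleForest G u par rank) (h : V → α) :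
    ∏ c with par c = none, h c = ∏ i, h (u i) := by
  rw [← Finset.prod_image (s := Finset.univ) (g := u) (f := h) (by simpa using hG.injective)]
  congr 1
  ext v
  simp [hG.par_eq_none]

/-- Each non-root is a child of exactly one vertex, so the product over all families regroups.
Cancelling the common factor turns a fold at the roots into a product over non-roots. -/
theorem fold_roots {α : Type*} [CommMonoid α] {G : SimpleGraph V} {g : ℕ} {u : Fin g → V}
    (hG : IsCycleForest G u par rank) {f h : V → α}
    (hf : ∀ v, f v = ∏ c with par c = some v, h c) :
    (∏ c with par c ≠ none, h c) = (∏ c with par c ≠ none, f c) * ∏ i, f (u i) := by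
  rw [← prod_prod_children, ← prod_roots hG, mul_comm,
    Finset.prod_filter_mul_prod_filter_not]
  exact Finset.prod_congr rfl fun v _ => (hf v).symm

end Fold

section Det
variable {V : Type*} [Fintype V] [DecidableEq V] {G : SimpleGraph V} [DecidableRel G.Adj]
  {g : ℕ} {u : Fin g → V} {par : V → Option V} {rank : V → ℕ}

theorem det_one_add_of_rank {Q : Matrix V V ℝ} (rank : V → ℕ)
    (h : ∀ a c, Q a c ≠ 0 → rank a < rank c) : (1 + Q).det = 1 := by
  have htri : (1 + Q).BlockTriangular rank := by
    intro a c hac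
    have hne : a ≠ c := by rintro rfl; exact lt_irrefl _ hac
    have : Q a c = 0 := by
      by_contra hQ
      exact lt_asymm hac (h a c hQ)
    simp [hne, this]
  rw [htri.det]
  refine Finset.prod_eq_one fun k _ => ?_
  have : (1 + Q).toSquareBlock rank k = 1 := by
    ext a c
    have : Q a c = 0 := by
      by_contra hQ
      exact (h _ _ hQ).ne (a.2.trans c.2.symm)
    simp [toSquareBlock_def, this, Matrix.one_apply, Subtype.ext_iff]
  rw [this, det_one]

theorem snd_div_fst_prod {ι : Type*} (s : Finset ι) {f : ι → DualNumber ℝ}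
    (h : ∀ i ∈ s, Admissible (f i)) :
    (∏ i ∈ s, f i).snd / (∏ i ∈ s, f i).fst = ∑ i ∈ s, (f i).snd / (f i).fst := by
  classical
  induction s using Finset.induction_on with
  | empty => simp
  | insert i s hi ih =>
    have h1 := (h i (Finset.mem_insert_self _ _)).1.ne'
    have h2 := (Admissible.prod s fun j hj => h j (Finset.mem_insert_of_mem hj)).1.ne'
    rw [Finset.prod_insert hi, Finset.sum_insert hi,
      ← ih fun j hj => h j (Finset.mem_insert_of_mem hj), dual_fst_mul, dual_snd_mul]
    field_simp
    ring

theorem fst_prod {ι : Type*} (s : Finset ι) (f : ι → DualNumber ℝ) :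
    (∏ i ∈ s, f i).fst = ∏ i ∈ s, (f i).fst :=
  map_prod (TrivSqZeroExt.fstHom ℝ ℝ ℝ) f s

omit [DecidableRel G.Adj] in
theorem admissible_fold (hG : IsCycleForest G u par rank) {x : ℝ} (hx : 0 < x)
    {f : V → DualNumber ℝ} (hf : ∀ v, f v = ∏ c with par c = some v, hang x (f c)) (v : V) :
    Admissible (f v) := by
  refine forest_induction hG.rank_lt (P := fun v => Admissible (f v)) (fun v ih => ?_) v
  rw [hf]
  exact Admissible.prod _ fun c hc => (ih c (by simpa using hc)).hang hx

/-- Elimination of the trees: the determinant of `x + L(G)` is determined by the dual numbers of the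
trees attached to the cycle. -/
theorem det_diagonal_add_lapMatrix (hG : IsCycleForest G u par rank) {x : ℝ} (hx : 0 < x)
    {f : V → DualNumber ℝ} (hf : ∀ v, f v = ∏ c with par c = some v, hang x (f c)) :
    (diagonal (fun _ => x) + G.lapMatrix ℝ).det =
      (∏ i, (f (u i)).fst) * (cycleMatrix g fun i => x + (f (u i)).snd / (f (u i)).fst).det := by
  have hadm := admissible_fold hG hx hf
  classical
  -- `1 + y v` is the pivot at a non-root `v` once its descendants are eliminated; the `1` is the
  -- edge to the parent, recorded by `e` below.
  set y : V → ℝ := fun v => x + (f v).snd / (f v).fst with hy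
  have hypos : ∀ v, 0 < 1 + y v := fun v => by
    have := (hadm v).1
    have := (hadm v).2
    positivity
  let κ : V → V → ℝ := fun a b =>
    if ∃ i j, u i = a ∧ u j = b ∧ (SimpleGraph.cycleGraph g).Adj i j then 1 else 0
  have κ_comm : ∀ a b, κ a b = κ b a := by
    intro a b
    simp only [κ]
    congr 1
    exact propext ⟨fun ⟨i, j, h1, h2, h3⟩ => ⟨j, i, h2, h1, h3.symm⟩,
      fun ⟨i, j, h1, h2, h3⟩ => ⟨j, i, h2, h1, h3.symm⟩⟩
  have κ_zero : ∀ a b, par a ≠ none → κ a b = 0 := by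
    intro a b ha
    simp only [κ]
    rw [if_neg]
    rintro ⟨i, j, rfl, -, -⟩
    exact ha ((hG.par_eq_none _).2 ⟨i, rfl⟩)
  let e : V → ℝ := fun a => if par a = none then 0 else 1
  let D : Matrix V V ℝ := Matrix.of fun a b =>
    (if a = b then y a + ∑ b, κ a b + e a else 0) - κ a b
  have κ_self : ∀ a, κ a a = 0 := by
    intro a
    simp only [κ]
    rw [if_neg]
    rintro ⟨i, j, h1, h2, h3⟩
    exact h3.ne (hG.injective (h1.trans h2.symm))
  have D_nonroot : ∀ a b, par a ≠ none → D a b = if a = b then 1 + y a else 0 := by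
    intro a b ha
    simp only [D, of_apply, κ_zero _ _ ha, e, if_neg ha, Finset.sum_const_zero]
    split_ifs <;> ring
  have D_symm : Dᵀ = D := by
    ext a b
    simp only [D, of_apply, transpose_apply, κ_comm b a]
    by_cases h : a = b
    · subst h; rfl
    · rw [if_neg h, if_neg (Ne.symm h)]
  let N : Matrix V V ℝ := Matrix.of fun a c => if par c = some a then 1 else 0
  let Q : Matrix V V ℝ := Matrix.of fun a c => if par c = some a then -(1 + y c)⁻¹ else 0
  have hQD : Q * D = -N := by
    ext a b
    rw [mul_apply, Finset.sum_eq_single b]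
    · simp only [Q, N, of_apply, Matrix.neg_apply]
      by_cases h : par b = some a
      · rw [D_nonroot b b (by simp [h]), if_pos rfl, if_pos h, if_pos h, neg_mul,
          inv_mul_cancel₀ (hypos b).ne']
      · simp [h]
    · intro c _ hcb
      simp only [Q, of_apply]
      split_ifs with h
      · rw [D_nonroot c b (by simp [h]), if_neg hcb, mul_zero]
      · simp
    · simp
  have hDQ : D * Qᵀ = -Nᵀ := by
    rw [← transpose_neg, ← hQD, transpose_mul, D_symm]
  have hNQ : N * Qᵀ = diagonal fun a => ∑ c with par c = some a, -(1 + y c)⁻¹ := by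
    ext a b
    rw [mul_apply]
    by_cases h : a = b
    · subst h
      rw [diagonal_apply_eq, Finset.sum_filter]
      refine Finset.sum_congr rfl fun c _ => ?_
      simp only [N, Q, of_apply, transpose_apply]
      split_ifs <;> simp
    · rw [diagonal_apply_ne _ h]
      refine Finset.sum_eq_zero fun c _ => ?_
      simp only [N, Q, of_apply, transpose_apply]
      split_ifs with h1 h2
      · exact absurd (Option.some_injective _ (h1.symm.trans h2)) h
      all_goals simp
  have hadj : ∀ a b, (if G.Adj a b then 1 else 0 : ℝ) = κ a b + N a b + N b a := by
    intro a b
    simp only [κ, N, of_apply]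
    have h1 : ¬ (par a = some b ∧ par b = some a) := fun h =>
      lt_asymm (hG.rank_lt _ _ h.1) (hG.rank_lt _ _ h.2)
    have h2 : ∀ i, par (u i) = none := fun i => (hG.par_eq_none _).2 ⟨i, rfl⟩
    by_cases h3 : ∃ i j, u i = a ∧ u j = b ∧ (SimpleGraph.cycleGraph g).Adj i j
    · rw [if_pos ((hG.adj_iff a b).2 (.inr (.inr h3))), if_pos h3]
      obtain ⟨i, j, rfl, rfl, -⟩ := h3
      simp [h2]
    · rw [if_neg h3]
      have := hG.adj_iff a b
      by_cases ha : par a = some b <;> by_cases hb : par b = some a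
      · exact absurd ⟨ha, hb⟩ h1
      all_goals simp only [this, ha, hb, h3]; simp
  have hsumN : ∀ a, ∑ b, N b a = e a := by
    intro a
    simp only [N, e, of_apply]
    rcases ha : par a with _ | v
    · simp
    · simp
  have hyrec : ∀ a, y a = x + ∑ c with par c = some a, (1 - (1 + y c)⁻¹) := by
    intro a
    simp only [hy]
    conv_lhs => rw [hf a]
    rw [snd_div_fst_prod _ fun c _ => (hadm c).hang hx]
    congr 1
    refine Finset.sum_congr rfl fun c _ => ?_
    have h1 := (hadm c).1
    have h2 := (hadm c).2
    have h3 : (1 + x) * (f c).fst + (f c).snd ≠ 0 := by positivity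
    have h4 : 1 + (x + (f c).snd / (f c).fst) = ((1 + x) * (f c).fst + (f c).snd) / (f c).fst := by
      field_simp; ring
    rw [h4, fst_hang, snd_hang, inv_div]
    field_simp
    ring
  -- Symmetric Gaussian elimination: `1 + Q` is unipotent because `Q` strictly raises the rank, and
  -- `D` is the weighted cycle together with the pivots.
  have hfactor : diagonal (fun _ => x) + G.lapMatrix ℝ = (1 + Q) * D * (1 + Q)ᵀ := by
    rw [transpose_add, transpose_one, Matrix.mul_add, Matrix.mul_one, Matrix.add_mul, Matrix.one_mul,
      hQD, Matrix.add_mul, hDQ, Matrix.neg_mul, hNQ]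
    ext a b
    by_cases h : a = b
    · subst h
      have hNa : N a a = 0 := by
        simp only [N, of_apply]
        rw [if_neg]
        intro h
        exact lt_irrefl _ (hG.rank_lt _ _ h)
      simp only [Matrix.add_apply, Matrix.neg_apply, diagonal_apply_eq, lapMatrix_apply_self,
        transpose_apply, hNa, D, of_apply, if_true, κ_self]
      rw [SimpleGraph.degree_eq_sum_if_adj]
      simp only [hadj, Finset.sum_add_distrib, hsumN]
      have : ∑ b, N a b = ∑ c with par c = some a, (1 : ℝ) := by
        rw [Finset.sum_filter]; rfl
      rw [this, hyrec a]
      simp only [Finset.sum_sub_distrib, Finset.sum_neg_distrib]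
      ring
    · simp only [Matrix.add_apply, Matrix.neg_apply, diagonal_apply_ne _ h, lapMatrix_apply_ne _ h,
        transpose_apply, D, of_apply, if_neg h, hadj]
      ring
  have hdetP : (1 + Q).det = 1 := by
    refine det_one_add_of_rank rank fun a c hQ => hG.rank_lt c a ?_
    by_contra h
    exact hQ (by simp [Q, h])
  rw [hfactor, det_mul, det_mul, det_transpose, hdetP, one_mul, mul_one,
    twoBlockTriangular_det D (fun v => par v = none) (fun a ha b hb => by
      rw [D_nonroot a b ha, if_neg]
      rintro rfl
      exact ha hb), mul_comm]
  congr 1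
  · have : (toSquareBlockProp D fun v => ¬par v = none) =
        diagonal fun v : {v // ¬par v = none} => 1 + y v := by
      ext a b
      simp only [toSquareBlockProp_def, of_apply, D_nonroot _ _ a.2, diagonal_apply, Subtype.ext_iff]
    rw [this, det_diagonal,
      ← Finset.prod_subtype (Finset.univ.filter fun v => par v ≠ none) (by simp) fun v => 1 + y v]
    -- The product of the pivots telescopes to the `fst` values at the roots.
    have h := fold_roots hG (f := fun v => (f v).fst) (h := fun v => (hang x (f v)).fst)
      fun v => by rw [hf v, fst_prod]
    have h1 : ∀ v, (hang x (f v)).fst = (f v).fst * (1 + y v) := by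
      intro v
      have := (hadm v).1
      simp only [fst_hang, hy]
      field_simp
      ring
    simp only [h1, Finset.prod_mul_distrib] at h
    exact mul_left_cancel₀ (Finset.prod_ne_zero_iff.2 fun v _ => (hadm v).1.ne') h
  · let E : Fin g ≃ {v // par v = none} := Equiv.ofBijective
      (fun i => ⟨u i, (hG.par_eq_none _).2 ⟨i, rfl⟩⟩)
      ⟨fun i j h => hG.injective (congrArg Subtype.val h), fun ⟨v, hv⟩ => by
        obtain ⟨i, rfl⟩ := (hG.par_eq_none v).1 hv
        exact ⟨i, rfl⟩⟩
    have hE : ∀ i, (E i : V) = u i := fun _ => rfl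
    rw [← det_submatrix_equiv_self E]
    congr 1
    have hκ : ∀ i j, κ (u i) (u j) = if (SimpleGraph.cycleGraph g).Adj i j then 1 else 0 := by
      intro i j
      have : (∃ i' j', u i' = u i ∧ u j' = u j ∧ (SimpleGraph.cycleGraph g).Adj i' j') ↔
          (SimpleGraph.cycleGraph g).Adj i j :=
        ⟨fun ⟨i', j', h1, h2, h3⟩ => by rwa [← hG.injective h1, ← hG.injective h2],
          fun h => ⟨i, j, rfl, rfl, h⟩⟩
      simp only [κ, this]
    ext i j
    have hpar : par (u i) = none := (hG.par_eq_none _).2 ⟨i, rfl⟩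
    simp only [submatrix_apply, toSquareBlockProp_def, of_apply, hE, D, cycleMatrix,
      Matrix.add_apply]
    by_cases hij : i = j
    · subst hij
      have hsum : ∑ b, κ (u i) b = ∑ j, κ (u i) (u j) := by
        refine (Fintype.sum_of_injective u hG.injective _ _ (fun b hb => ?_) fun _ => rfl).symm
        rw [κ_comm, κ_zero]
        exact fun h => hb ((hG.par_eq_none _).1 h)
      rw [if_pos rfl, κ_self, diagonal_apply_eq, lapMatrix_apply_self, hsum,
        SimpleGraph.degree_eq_sum_if_adj]
      simp [hκ, e, hpar, hy]
    · rw [if_neg fun h => hij (hG.injective h), diagonal_apply_ne _ hij,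
        lapMatrix_apply_ne _ hij, hκ]
      ring

end Det

end UnicyclicLEL

/-! ### Parent functions of trees, and leaf and edge counts. -/

namespace UnicyclicLEL
open Matrix

section Tree

theorem exists_adj_dist_lt {W : Type*} {T : SimpleGraph W} (hT : T.Connected) {r v : W}
    (hv : v ≠ r) : ∃ w, T.Adj v w ∧ T.dist w r < T.dist v r := by
  obtain ⟨p, hp⟩ := (hT v r).exists_walk_length_eq_dist
  cases p with
  | nil => exact absurd rfl hv
  | cons h q =>
    refine ⟨_, h, ?_⟩
    rw [← hp, SimpleGraph.Walk.length_cons]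
    exact Nat.lt_succ_of_le (SimpleGraph.dist_le q)

/-- The parent is a neighbour closer to the root. The edges to parents are distinct and as numerous
as the edges of the tree, so they are all its edges. -/
theorem exists_parent {W : Type*} [Finite W] {T : SimpleGraph W} (hT : T.IsTree) (r : W) :
    ∃ (par : W → Option W) (rank : W → ℕ), (∀ v, par v = none ↔ v = r) ∧
      (∀ c v, par c = some v → rank v < rank c) ∧
      ∀ a b, T.Adj a b ↔ par a = some b ∨ par b = some a := by
  classical
  have := Fintype.ofFinite W
  choose! q hq using fun v (hv : v ≠ r) => exists_adj_dist_lt hT.connected hv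
  let φ : {v // v ≠ r} → T.edgeSet := fun v => ⟨s(v.1, q v), (hq v v.2).1⟩
  have hinj : Function.Injective φ := by
    rintro ⟨v, hv⟩ ⟨w, hw⟩ h
    have h : s(v, q v) = s(w, q w) := congrArg Subtype.val h
    rcases Sym2.eq_iff.1 h with ⟨h1, -⟩ | ⟨h1, h2⟩
    · exact Subtype.ext h1
    · have h3 := (hq v hv).2
      have h4 := (hq w hw).2
      rw [h2] at h3
      rw [← h1] at h4
      exact absurd h3 h4.not_gt
  have hcard : Fintype.card {v // v ≠ r} = Fintype.card T.edgeSet := by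
    have h := hT.card_edgeFinset
    rw [SimpleGraph.edgeFinset, Set.toFinset_card] at h
    rw [Fintype.card_subtype_compl, Fintype.card_subtype_eq]
    omega
  have hsurj := ((Fintype.bijective_iff_injective_and_card φ).2 ⟨hinj, hcard⟩).2
  have hpar : ∀ a b, (if a = r then none else some (q a)) = some b ↔ a ≠ r ∧ q a = b := by
    intro a b
    split_ifs with h <;> simp [h]
  refine ⟨fun v => if v = r then none else some (q v), fun v => T.dist v r, fun v => ?_,
    fun c v hc => ?_, fun a b => ?_⟩
  · by_cases h : v = r <;> simp [h]
  · obtain ⟨h, rfl⟩ := (hpar c v).1 hc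
    exact (hq c h).2
  · rw [hpar, hpar]
    constructor
    · intro hab
      obtain ⟨⟨v, hv⟩, h⟩ := hsurj ⟨s(a, b), hab⟩
      have h : s(v, q v) = s(a, b) := congrArg Subtype.val h
      rcases Sym2.eq_iff.1 h with ⟨rfl, h2⟩ | ⟨rfl, h2⟩
      · exact .inl ⟨hv, h2⟩
      · exact .inr ⟨hv, h2⟩
    · rintro (⟨h, rfl⟩ | ⟨h, rfl⟩)
      · exact (hq _ h).1
      · exact (hq _ h).1.symm

end Tree

theorem IsCycleWithTrees.exists_isCycleForest {V : Type*} [Finite V] {G : SimpleGraph V} {g : ℕ}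
    {u : Fin g → V} {τ : V → Fin g} (h : IsCycleWithTrees G g u τ) :
    ∃ par rank, IsCycleForest G u par rank ∧ ∀ c v, par c = some v → τ c = τ v := by
  choose p rk h1 h2 h3 using fun i => exists_parent (h.isTree i) ⟨u i, h.root_mem i⟩
  have hpar : ∀ c v, (p (τ c) ⟨c, rfl⟩).map Subtype.val = some v ↔
      ∃ hv : τ v = τ c, p (τ c) ⟨c, rfl⟩ = some ⟨v, hv⟩ := by
    intro c v
    rw [Option.map_eq_some_iff]
    constructor
    · rintro ⟨⟨w, hw⟩, h, rfl⟩
      exact ⟨hw, h⟩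
    · rintro ⟨hv, h⟩
      exact ⟨_, h, rfl⟩
  have hp : ∀ i v (hv : τ v = i) w (hw : τ w = i), p (τ v) ⟨v, rfl⟩ = some ⟨w, hw.trans hv.symm⟩ ↔
      p i ⟨v, hv⟩ = some ⟨w, hw⟩ := by
    rintro i v rfl w hw
    rfl
  have hrk : ∀ i v (hv : τ v = i), rk (τ v) ⟨v, rfl⟩ = rk i ⟨v, hv⟩ := by
    rintro i v rfl; rfl
  refine ⟨fun v => (p (τ v) ⟨v, rfl⟩).map Subtype.val, fun v => rk (τ v) ⟨v, rfl⟩,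
    ⟨fun i j hij => ?_, fun v => ?_, fun c v hc => ?_, fun a b => ?_⟩, fun c v hc => ?_⟩
  · rw [← h.root_mem i, hij, h.root_mem]
  · rw [Option.map_eq_none_iff, h1, Subtype.ext_iff]
    constructor
    · intro hv
      exact ⟨_, hv.symm⟩
    · rintro ⟨i, rfl⟩
      exact (congrArg u (h.root_mem i)).symm
  · obtain ⟨hv, hc⟩ := (hpar c v).1 hc
    rw [hrk _ v hv]
    exact h2 _ _ _ hc
  · rw [hpar, hpar]
    by_cases hab : τ a = τ b
    · have h4 := h3 (τ a) ⟨a, rfl⟩ ⟨b, hab.symm⟩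
      rw [SimpleGraph.induce_adj] at h4
      rw [h4]
      constructor
      · rintro (h5 | h5)
        · exact .inl ⟨_, h5⟩
        · exact .inr (.inl ⟨hab, (hp _ b hab.symm a rfl).2 h5⟩)
      · rintro (⟨_, h5⟩ | ⟨_, h5⟩ | ⟨i, j, rfl, rfl, h5⟩)
        · exact .inl h5
        · exact .inr ((hp _ b hab.symm a rfl).1 h5)
        · rw [h.root_mem, h.root_mem] at hab
          exact absurd hab h5.ne
    · rw [h.adj_iff a b hab]
      constructor
      · rintro ⟨h4, h5, h6⟩
        exact .inr (.inr ⟨_, _, h4.symm, h5.symm, h6⟩)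
      · rintro (⟨h4, -⟩ | ⟨h4, -⟩ | ⟨i, j, rfl, rfl, h4⟩)
        · exact absurd h4.symm hab
        · exact absurd h4 hab
        · simpa [h.root_mem] using h4
  · exact ((hpar c v).1 hc).1.symm

section Count
variable {V : Type*} [Fintype V] [DecidableEq V] {G : SimpleGraph V}
  {g : ℕ} {u : Fin g → V} {par : V → Option V} {rank : V → ℕ}

theorem exists_fold_add (hr : ∀ c v, par c = some v → rank v < rank c) (op : ℕ → ℕ) :
    ∃ f : V → ℕ, ∀ v, f v = ∑ c with par c = some v, op (f c) :=
  exists_fold (α := Multiplicative ℕ) hr op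

theorem fold_add_roots (hG : IsCycleForest G u par rank) {f h : V → ℕ}
    (hf : ∀ v, f v = ∑ c with par c = some v, h c) :
    (∑ c with par c ≠ none, h c) = (∑ c with par c ≠ none, f c) + ∑ i, f (u i) :=
  fold_roots (α := Multiplicative ℕ) hG hf

theorem IsRootedTree.prod {x : ℝ} {ι : Type*} (s : Finset ι) {f : ι → DualNumber ℝ} {l m : ι → ℕ}
    (h : ∀ i ∈ s, IsRootedTree x (f i) (l i) (m i)) :
    IsRootedTree x (∏ i ∈ s, f i) (∑ i ∈ s, l i) (∑ i ∈ s, m i) := by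
  classical
  induction s using Finset.induction_on with
  | empty => simpa using .one
  | insert i s hi ih =>
    rw [Finset.prod_insert hi, Finset.sum_insert hi, Finset.sum_insert hi]
    exact (h i (Finset.mem_insert_self _ _)).mul
      (ih fun j hj => h j (Finset.mem_insert_of_mem hj))

theorem isRootedTree_fold (hG : IsCycleForest G u par rank) {x : ℝ} {f : V → DualNumber ℝ}
    (hf : ∀ v, f v = ∏ c with par c = some v, hang x (f c)) {l m : V → ℕ}
    (hl : ∀ v, l v = ∑ c with par c = some v, max (l c) 1)
    (hm : ∀ v, m v = ∑ c with par c = some v, (m c + 1)) (v : V) :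
    IsRootedTree x (f v) (l v) (m v) := by
  refine forest_induction hG.rank_lt (P := fun v => IsRootedTree x (f v) (l v) (m v))
    (fun v ih => ?_) v
  rw [hf, hl, hm]
  exact IsRootedTree.prod _ fun c hc => (ih c (by simpa using hc)).hang

theorem leafCount_eq_zero {l : V → ℕ} (hl : ∀ v, l v = ∑ c with par c = some v, max (l c) 1)
    (v : V) : l v = 0 ↔ ∀ c, par c ≠ some v := by
  rw [hl, Finset.sum_eq_zero_iff]
  simp

omit [DecidableEq V] in
-- Cycle vertices have two neighbours on the cycle, and elsewhere the parent is one neighbour, so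
-- the leaves are the childless vertices off the cycle.
theorem ncard_neighborSet_eq_one (hG : IsCycleForest G u par rank) (hg : 3 ≤ g) (v : V) :
    (G.neighborSet v).ncard = 1 ↔ par v ≠ none ∧ ∀ c, par c ≠ some v := by
  rcases hv : par v with _ | w
  · obtain ⟨i, rfl⟩ := (hG.par_eq_none v).1 hv
    simp only [ne_eq, not_true_eq_false, false_and, iff_false]
    have hsub : u '' (SimpleGraph.cycleGraph g).neighborSet i ⊆ G.neighborSet (u i) := by
      rintro _ ⟨j, hj, rfl⟩
      exact (hG.adj_iff _ _).2 (.inr (.inr ⟨i, j, rfl, rfl, hj⟩))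
    have h1 := Set.ncard_le_ncard hsub (Set.toFinite _)
    rw [Set.ncard_image_of_injective _ hG.injective] at h1
    have h2 : ((SimpleGraph.cycleGraph g).neighborSet i).ncard = 2 := by
      obtain ⟨n, rfl⟩ := Nat.exists_eq_add_of_le' hg
      rw [← SimpleGraph.cycleGraph_degree_three_le (n := n) (v := i), Set.ncard_eq_toFinset_card']
      rfl
    omega
  · simp only [ne_eq, reduceCtorEq, not_false_eq_true, true_and]
    have hw : w ∈ G.neighborSet v := (hG.adj_iff _ _).2 (.inl hv)
    constructor
    · intro h c hc
      have hcv : c ∈ G.neighborSet v := (hG.adj_iff _ _).2 (.inr (.inl hc))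
      obtain ⟨a, ha⟩ := Set.ncard_eq_one.1 h
      rw [ha] at hw hcv
      obtain rfl : c = w := hcv.trans hw.symm
      exact lt_asymm (hG.rank_lt _ _ hc) (hG.rank_lt _ _ hv)
    · intro h
      rw [Set.ncard_eq_one]
      refine ⟨w, Set.eq_singleton_iff_unique_mem.2 ⟨hw, fun c hc => ?_⟩⟩
      rcases (hG.adj_iff _ _).1 hc with h1 | h1 | ⟨i, j, rfl, -, -⟩
      · exact Option.some_injective _ (h1.symm.trans hv)
      · exact absurd h1 (h c)
      · rw [(hG.par_eq_none _).2 ⟨i, rfl⟩] at hv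
        cases hv

theorem sum_leafCount_roots (hG : IsCycleForest G u par rank) (hg : 3 ≤ g) {l : V → ℕ}
    (hl : ∀ v, l v = ∑ c with par c = some v, max (l c) 1) : ∑ i, l (u i) = numLeaves G := by
  have h1 := fold_add_roots hG hl
  -- The excess over `l c` marks the childless vertices, so the telescoped sum counts leaves.
  have h2 : ∀ c, max (l c) 1 = l c + if l c = 0 then 1 else 0 := by
    intro c; split_ifs <;> omega
  simp only [h2, Finset.sum_add_distrib] at h1
  rw [← Nat.add_left_cancel h1, ← Finset.card_filter, Finset.filter_filter, numLeaves]
  rw [← Set.ncard_coe_finset]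
  congr 1
  ext v
  simp [ncard_neighborSet_eq_one hG hg, leafCount_eq_zero hl]

theorem sum_edgeCount_roots (hG : IsCycleForest G u par rank) {m : V → ℕ}
    (hm : ∀ v, m v = ∑ c with par c = some v, (m c + 1)) :
    ∑ i, m (u i) + g = Fintype.card V := by
  have h1 := fold_add_roots hG hm
  rw [Finset.sum_add_distrib] at h1
  have h2 := Finset.card_filter_add_card_filter_not (s := (Finset.univ : Finset V)) fun v => par v = none
  have h3 : (Finset.univ.filter fun v => par v = none).card = g := by
    have : (Finset.univ.filter fun v => par v = none) = Finset.univ.map ⟨u, hG.injective⟩ := by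
      ext v; simp [hG.par_eq_none]
    rw [this]; simp
  rw [← Nat.add_left_cancel h1, ← Finset.card_eq_sum_ones, add_comm, ← Finset.card_univ, ← h2, h3]

end Count

end UnicyclicLEL

/-! ### The balanced starlike graph and the final comparison. -/

namespace UnicyclicLEL
open Matrix

/-- The parent function of `balancedStarlike n l g 0`. -/
def balancedPar (n l g : ℕ) (v : Fin n) : Option (Fin n) :=
  if h : (v : ℕ) < g ∨ l = 0 then none else some ⟨max (g - 1) ((v : ℕ) - l), by omega⟩

theorem balancedPar_eq_none {n l g : ℕ} (hl : l ≠ 0) (v : Fin n) :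
    balancedPar n l g v = none ↔ (v : ℕ) < g := by
  unfold balancedPar
  split_ifs with h <;> simp <;> omega

theorem balancedPar_eq_some {n l g : ℕ} (hl : l ≠ 0) (c v : Fin n) :
    balancedPar n l g c = some v ↔ g ≤ (c : ℕ) ∧ (v : ℕ) = max (g - 1) ((c : ℕ) - l) := by
  unfold balancedPar
  split_ifs with h
  · simp; omega
  · rw [Option.some_inj, Fin.ext_iff]
    change max (g - 1) ((c : ℕ) - l) = v ↔ _
    omega

theorem cycleGraph_adj_iff {g : ℕ} (hg : 3 ≤ g) (i j : Fin g) :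
    (SimpleGraph.cycleGraph g).Adj i j ↔ (j : ℕ) = i + 1 ∨ (i : ℕ) = j + 1 ∨
      ((i : ℕ) = 0 ∧ (j : ℕ) = g - 1) ∨ ((j : ℕ) = 0 ∧ (i : ℕ) = g - 1) := by
  rw [SimpleGraph.cycleGraph_adj']
  have hi := i.2
  have hj := j.2
  rcases lt_trichotomy i j with h | rfl | h
  · rw [Fin.coe_sub_iff_lt.2 h, Fin.sub_val_of_le h.le]
    have : (i : ℕ) < j := h
    omega
  · rw [Fin.sub_val_of_le le_rfl]
    omega
  · rw [Fin.coe_sub_iff_lt.2 h, Fin.sub_val_of_le h.le]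
    have : (j : ℕ) < i := h
    omega

theorem isCycleForest_balancedStarlike {n l g : ℕ} (hg : 3 ≤ g) (hl : l ≠ 0) (hgn : g ≤ n) :
    IsCycleForest (balancedStarlike n l g 0) (Fin.castLE hgn) (balancedPar n l g)
      (fun v => (v : ℕ)) := by
  refine ⟨Fin.castLE_injective hgn, fun v => ?_, fun c v hc => ?_, fun a b => ?_⟩
  · rw [balancedPar_eq_none hl]
    constructor
    · intro h
      exact ⟨⟨v, h⟩, rfl⟩
    · rintro ⟨i, rfl⟩
      exact i.2
  · rw [balancedPar_eq_some hl] at hc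
    omega
  · have hcyc : (∃ i j, Fin.castLE hgn i = a ∧ Fin.castLE hgn j = b ∧
        (SimpleGraph.cycleGraph g).Adj i j) ↔ (a : ℕ) < g ∧ (b : ℕ) < g ∧
        ((b : ℕ) = a + 1 ∨ (a : ℕ) = b + 1 ∨
      ((a : ℕ) = 0 ∧ (b : ℕ) = g - 1) ∨ ((b : ℕ) = 0 ∧ (a : ℕ) = g - 1)) := by
      constructor
      · rintro ⟨i, j, rfl, rfl, h⟩
        exact ⟨i.2, j.2, (cycleGraph_adj_iff hg i j).1 h⟩
      · rintro ⟨ha, hb, h⟩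
        exact ⟨⟨a, ha⟩, ⟨b, hb⟩, rfl, rfl, (cycleGraph_adj_iff hg _ _).2 h⟩
    rw [hcyc, balancedPar_eq_some hl, balancedPar_eq_some hl, balancedStarlike,
      SimpleGraph.fromRel_adj, ne_eq, Fin.ext_iff]
    clear hcyc
    omega

theorem det_balancedStarlike {n l g : ℕ} (hg : 3 ≤ g) (hl : l ≠ 0) (hn : g + l ≤ n)
    [DecidableRel (balancedStarlike n l g 0).Adj] {x K D : ℝ} (hx : 0 < x)
    (hKD : ∀ k s, (cycleMatrix g (Function.update (fun _ => x) k (x + s))).det =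
      K + D * (x + s)) :
    (diagonal (fun _ => x) + (balancedStarlike n l g 0).lapMatrix ℝ).det =
      val x K D (starlike x (balancedLegs l (n - g))) := by
  have hgn : g ≤ n := by omega
  have hG := isCycleForest_balancedStarlike hg hl hgn
  obtain ⟨f, hf⟩ := exists_fold hG.rank_lt (hang x)
  obtain ⟨m, hm⟩ := exists_fold_add hG.rank_lt (· + 1)
  -- Beyond `v` its leg continues `v + l, v + 2l, …` as long as the labels stay below `n`.
  have hpath : ∀ v : Fin n, g ≤ (v : ℕ) → m v = (n - 1 - v) / l ∧ f v = pendant x (m v) := by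
    intro v
    refine forest_induction hG.rank_lt (P := fun v : Fin n => g ≤ (v : ℕ) →
      m v = (n - 1 - v) / l ∧ f v = pendant x (m v)) (fun v ih hv => ?_) v
    have hchild : ∀ c : Fin n, balancedPar n l g c = some v ↔ (c : ℕ) = v + l := by
      intro c
      rw [balancedPar_eq_some hl]
      omega
    by_cases hvl : (v : ℕ) + l < n
    · have hfilter : (Finset.univ.filter fun c => balancedPar n l g c = some v) =
          {⟨v + l, hvl⟩} := by
        ext c
        simp [hchild, Fin.ext_iff]
      obtain ⟨h1, h2⟩ := ih ⟨v + l, hvl⟩ ((hchild _).2 rfl) (by simp; omega)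
      have h3 : m v = m ⟨v + l, hvl⟩ + 1 := by rw [hm, hfilter, Finset.sum_singleton]
      refine ⟨?_, ?_⟩
      · rw [h3, h1, ← Nat.add_div_right _ (Nat.pos_of_ne_zero hl)]
        congr 1
        simp only
        omega
      · rw [hf, hfilter, Finset.prod_singleton, h2, h3, pendant, pendant,
          Function.iterate_succ_apply']
    · have hfilter : (Finset.univ.filter fun c => balancedPar n l g c = some v) = ∅ := by
        ext c
        simp only [hchild, Finset.mem_filter, Finset.mem_univ, true_and, Finset.notMem_empty,
          iff_false]
        omega
      have h3 : m v = 0 := by rw [hm, hfilter, Finset.sum_empty]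
      refine ⟨?_, ?_⟩
      · rw [h3, Nat.div_eq_of_lt (by omega)]
      · rw [hf, hfilter, h3]; rfl
  let k : Fin g := ⟨g - 1, by omega⟩
  have hchild : ∀ (i : Fin g) (c : Fin n), balancedPar n l g c = some (Fin.castLE hgn i) ↔
      i = k ∧ g ≤ (c : ℕ) ∧ (c : ℕ) < g + l := by
    intro i c
    have := i.2
    rw [balancedPar_eq_some hl, Fin.ext_iff, Fin.val_castLE]
    simp only [k]
    omega
  have hroot : ∀ i, i ≠ k → f (Fin.castLE hgn i) = 1 ∧ m (Fin.castLE hgn i) = 0 := by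
    intro i hi
    rw [hf, hm, Finset.filter_false_of_mem]
    · simp
    · intro c _ hc
      exact hi ((hchild _ _).1 hc).1
  set S : Finset (Fin n) :=
    Finset.univ.filter fun c => balancedPar n l g c = some (Fin.castLE hgn k) with hS
  have hmem : ∀ c, c ∈ S ↔ g ≤ (c : ℕ) ∧ (c : ℕ) < g + l := by
    intro c
    simp [hS, hchild]
  have hcard : S.card = l := by
    rw [← Finset.card_map Fin.valEmbedding]
    have : S.map Fin.valEmbedding = Finset.Ico g (g + l) := by
      ext c
      simp only [Finset.mem_map, hmem, Fin.valEmbedding_apply, Finset.mem_Ico]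
      constructor
      · rintro ⟨a, ha, rfl⟩
        exact ha
      · intro h
        exact ⟨⟨c, by omega⟩, h, rfl⟩
    rw [this, Nat.card_Ico]
    omega
  have hmk : m (Fin.castLE hgn k) = n - g := by
    have h1 := sum_edgeCount_roots hG hm
    rw [Finset.sum_eq_single k (fun i _ hi => (hroot i hi).2) (by simp), Fintype.card_fin] at h1
    omega
  have hfk : f (Fin.castLE hgn k) = starlike x (balancedLegs l (n - g)) := by
    have hlegs : S.val.map (fun c => m c + 1) = balancedLegs l (n - g) := by
      have h := eq_balancedLegs (s := S.val.map fun c => m c + 1) ?_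
      · rwa [Multiset.card_map, Finset.card_val, hcard,
          show (S.val.map fun c => m c + 1).sum = n - g from (hm _).symm.trans hmk] at h
      · intro a ha b hb
        obtain ⟨c, hc, rfl⟩ := Multiset.mem_map.1 ha
        obtain ⟨d, hd, rfl⟩ := Multiset.mem_map.1 hb
        have hc := (hmem c).1 hc
        have hd := (hmem d).1 hd
        rw [(hpath c hc.1).1, (hpath d hd.1).1]
        have := Nat.add_div_right (n - 1 - d) (Nat.pos_of_ne_zero hl)
        -- The first vertices of two legs differ by less than `l`, so the leg lengths differ by at
        -- most one.
        have := Nat.div_le_div_right (c := l) (show n - 1 - (c : ℕ) ≤ n - 1 - d + l by omega)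
        omega
    rw [← hlegs, starlike, Multiset.map_map, hf]
    refine Finset.prod_congr rfl fun c hc => ?_
    rw [(hpath c ((hmem c).1 hc).1).2, Function.comp_apply, pendant, pendant,
      Function.iterate_succ_apply']
  have hw : (fun i => x + (f (Fin.castLE hgn i)).snd / (f (Fin.castLE hgn i)).fst) =
      Function.update (fun _ => x) k
        (x + (f (Fin.castLE hgn k)).snd / (f (Fin.castLE hgn k)).fst) := by
    ext i
    rcases eq_or_ne i k with rfl | hi
    · simp
    · rw [Function.update_of_ne hi, (hroot i hi).1]
      simp
  rw [det_diagonal_add_lapMatrix hG hx hf, hw, hKD,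
    Finset.prod_eq_single k (fun i _ hi => by rw [(hroot i hi).1]; simp) (by simp), hfk]
  have := (admissible_starlike hx (balancedLegs l (n - g))).1
  simp only [val]
  field_simp

theorem det_balancedStarlike_lt {n l g : ℕ} {V : Type*} [Fintype V] [DecidableEq V]
    {G : SimpleGraph V} [DecidableRel G.Adj] [DecidableRel (balancedStarlike n l g 0).Adj]
    (hG : IsUnicyclicTwoTrees n l g G) {x : ℝ} (hx : 0 < x) :
    (diagonal (fun _ => x) + (balancedStarlike n l g 0).lapMatrix ℝ).det <
      (diagonal (fun _ => x) + G.lapMatrix ℝ).det := by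
  obtain ⟨hU, u, τ, hT, i, j, hij, hi, hj, hrest⟩ := hG
  obtain ⟨par, rank, hF, hτ⟩ := hT.exists_isCycleForest
  obtain ⟨f, hf⟩ := exists_fold hF.rank_lt (hang x)
  obtain ⟨lv, hlv⟩ := exists_fold_add hF.rank_lt (max · 1)
  obtain ⟨mv, hmv⟩ := exists_fold_add hF.rank_lt (· + 1)
  have hRT := isRootedTree_fold hF hf hlv hmv
  have hadm := admissible_fold hF hx hf
  have hroot : ∀ k, (τ ⁻¹' {k}).ncard = 1 → lv (u k) = 0 := by
    intro k hk
    rw [leafCount_eq_zero hlv]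
    intro c hc
    obtain ⟨a, ha⟩ := Set.ncard_eq_one.1 hk
    have h1 : c ∈ τ ⁻¹' {k} := (hτ _ _ hc).trans (hT.root_mem k)
    have h2 : u k ∈ τ ⁻¹' {k} := hT.root_mem k
    rw [ha] at h1 h2
    obtain rfl : c = u k := h1.trans h2.symm
    exact lt_irrefl _ (hF.rank_lt _ _ hc)
  have hone : ∀ k, k ≠ i → k ≠ j → f (u k) = 1 ∧ lv (u k) = 0 ∧ mv (u k) = 0 := by
    intro k hki hkj
    have h := hroot k (hrest k hki hkj)
    exact ⟨((hRT _).eq_one h).1, h, ((hRT _).eq_one h).2⟩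
  have hchild : ∀ k, 1 < (τ ⁻¹' {k}).ncard → ∃ c, par c = some (u k) := by
    intro k hk
    obtain ⟨a, ha, hne⟩ := Set.exists_ne_of_one_lt_ncard hk (u k)
    have key : ∀ v, τ v = k → v ≠ u k → ∃ c, par c = some (u k) := by
      intro v
      induction hr : rank v using Nat.strong_induction_on generalizing v with
      | _ r ih =>
        intro hv hne
        rcases hp : par v with _ | w
        · obtain ⟨k', rfl⟩ := (hF.par_eq_none v).1 hp
          rw [hT.root_mem] at hv
          exact absurd (congrArg u hv) hne
        · by_cases hw : w = u k
          · exact ⟨v, hw ▸ hp⟩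
          · exact ih _ (hr ▸ hF.rank_lt _ _ hp) w rfl ((hτ _ _ hp).symm.trans hv) hw
    exact key a ha hne
  have hnz : ∀ k, 1 < (τ ⁻¹' {k}).ncard → lv (u k) ≠ 0 ∧ 0 < (f (u k)).snd := by
    intro k hk
    obtain ⟨c, hc⟩ := hchild k hk
    refine ⟨fun h => (leafCount_eq_zero hlv _).1 h c hc, ?_⟩
    rw [hf, ← Finset.mul_prod_erase _ _ (a := c) (by simpa using hc), dual_snd_mul, snd_hang]
    have h1 := hadm c
    have h2 := Admissible.prod ((Finset.univ.filter fun c => par c = some (u k)).erase c)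
      fun d _ => (hadm d).hang hx
    have h3 := h1.1
    have h4 := h1.2
    have h5 := h2.1
    have h6 := h2.2
    have h7 := (h1.hang hx).1
    positivity
  obtain ⟨hli, hsi⟩ := hnz i hi
  obtain ⟨hlj, hsj⟩ := hnz j hj
  have hl : lv (u i) + lv (u j) = l := by
    rw [← hU.leaves_eq, ← sum_leafCount_roots hF hT.three_le hlv,
      Fintype.sum_eq_add i j hij fun k hk => (hone k hk.1 hk.2).2.1]
  have hm : mv (u i) + mv (u j) + g = n := by
    rw [← hU.card_eq, ← sum_edgeCount_roots hF hmv,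
      Fintype.sum_eq_add i j hij fun k hk => (hone k hk.1 hk.2).2.2]
  -- This yields `g + l ≤ n`, which the evaluation of the balanced graph requires.
  have hlm : ∀ v, lv v ≤ mv v := by
    refine forest_induction hF.rank_lt fun v ih => ?_
    rw [hlv, hmv]
    refine Finset.sum_le_sum fun c hc => ?_
    have := ih c (by simpa using hc)
    omega
  have := hlm (u i)
  have := hlm (u j)
  obtain ⟨K, D, hK, hD, hKD, hlt⟩ := exists_cycle_context hT.three_le hx
  rw [det_balancedStarlike hT.three_le (by omega) (by omega) hx hKD,
    det_diagonal_add_lapMatrix hF hx hf]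
  have h1 := (hRT (u i)).val_balancedLegs_le hx hK hD.le (hRT (u j)) hli hlj
  rw [hl, show mv (u i) + mv (u j) = n - g by omega] at h1
  refine h1.trans_lt ?_
  have hai := (hadm (u i)).1
  have haj := (hadm (u j)).1
  have hw : (fun k => x + (f (u k)).snd / (f (u k)).fst) =
      Function.update (Function.update (fun _ => x) i (x + (f (u i)).snd / (f (u i)).fst)) j
        (x + (f (u j)).snd / (f (u j)).fst) := by
    ext k
    rcases eq_or_ne k j with rfl | hkj
    · simp
    · rw [Function.update_of_ne hkj]
      rcases eq_or_ne k i with rfl | hki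
      · simp
      · rw [Function.update_of_ne hki, (hone k hki hkj).1]
        simp
  rw [hw, Fintype.prod_eq_mul i j hij fun k hk => by rw [(hone k hk.1 hk.2).1]; simp]
  -- Multiplied by both `fst` values, the one-vertex side becomes `val x K D` of the product, since
  -- the weights `snd / fst` add under gluing.
  have h2 := mul_lt_mul_of_pos_left
    (hlt i j _ _ hij (div_pos hsi hai) (div_pos hsj haj)) (mul_pos hai haj)
  refine lt_of_eq_of_lt ?_ h2
  simp only [val, dual_fst_mul, dual_snd_mul]
  field_simp
  ring

end UnicyclicLEL

theorem corollary3p6 (n l g : ℕ) {V : Type*} [Fintype V] (G : SimpleGraph V)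
    (hG : UnicyclicLEL.IsUnicyclicTwoTrees n l g G) :
    UnicyclicLEL.LEL (UnicyclicLEL.balancedStarlike n l g 0) < UnicyclicLEL.LEL G := by
  classical
  refine UnicyclicLEL.LEL_lt_LEL _ _ ?_ fun x hx => ?_
  · rw [Fintype.card_fin, hG.1.card_eq]
  · convert UnicyclicLEL.det_balancedStarlike_lt hG hx
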